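/- Let $m,n$ be natural numbers, $Q=(0,1)^n\subset\mathbb{R}^n$ and $\alpha\in(0,1)$. For $\varphi\in C_c^\infty(\mathbb{R}^n)$ the Riesz fractional gradient is $$\nabla^{\alpha}\varphi(x)=\mu_{n,\alpha}\int_{\mathbb{R}^n}\frac{\varphi(y)-\varphi(x)}{|y-x|^{n+\alpha}}\,\frac{y-x}{|y-x|}\,dy,\quad x\in\mathbb{R}^n,\qquad \mu_{n,\alpha}=2^{\alpha}\pi^{-n/2}\,\frac{\Gamma\left(\frac{n+\alpha+1}{2}\right)}{\Gamma\left(\frac{1-\alpha}{2}\right)}.$$ For $u\in L^1(\mathbb{R}^n)+L^\infty(\mathbb{R}^n)$, a function $v\in L^1_{loc}(\mathbb{R}^n;\mathbb{R}^n)$ is the weak $\alpha$-fractional gradient of $u$, written $v=\nabla^\alpha u$, if $$\int_{\mathbb{R}^n} v\,\varphi\,dx=-\int_{\mathbb{R}^n}u\,\nabla^\alpha\varphi\,dx\qquad\text{for all }\varphi\in C_c^\infty(\mathbb{R}^n).$$ Let $S^{\alpha,\infty}(\mathbb{R}^n)$ be the space of all $u\in L^\infty(\mathbb{R}^n)$ that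 have a weak $\alpha$-fractional gradient in $L^\infty(\mathbb{R}^n;\mathbb{R}^n)$. Let $S^{\alpha,\infty}_{per}(Q;\mathbb{R}^m)$ be the set of all $u:\mathbb{R}^n\to\mathbb{R}^m$ whose components lie in $S^{\alpha,\infty}(\mathbb{R}^n)$ and which are $Q$-periodic, i.e. $u(x+e_i)=u(x)$ for a.e. $x\in\mathbb{R}^n$ and $i=1,\dots,n$; $\nabla^\alpha u$ is the $m\times n$ matrix field whose rows are the weak $\alpha$-fractional gradients of the components of $u$. Finally, $W^{1,\infty}_0(Q;\mathbb{R}^m)$ is the set of functions whose components lie in $L^\infty(Q)$, have a weak gradient in $L^\infty(Q;\mathbb{R}^n)$, and have zero boundary value on $\partial Q$ in the sense of the trace. Let $h:\mathbb{R}^{m\times n}\to\mathbb{R}$ be a Borel function. Call $h$ quasiconvex if for every $A\in\mathbb{R}^{m\times n}$ $$h(A)\le\int_Q h(A+\nabla\varphi)\,dy\qquad\text{for all }\varphi\in W^{1,\infty}_0(Q;\mathbb{R}^m),$$ and $\alpha$-quasiconvex if for every $A\in\mathbb{R}^{m\times n}$ $$h(A)\le\int_Q h(A+\nabla^\alpha\varphi)\,dy\qquad\text{for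 all }\varphi\in S^{\alpha,\infty}_{per}(Q;\mathbb{R}^m),$$ where in both inequalities the integral on the right is required to exist as a finite Lebesgue integral. Then $h$ is quasiconvex if and only if $h$ is $\alpha$-quasiconvex. -/

import Mathlib

open MeasureTheory Set
open scoped ContDiff

noncomputable section

namespace FracQC

/-- `ℝⁿ` with the Euclidean norm and Lebesgue measure. -/
abbrev E (n : ℕ) := EuclideanSpace ℝ (Fin n)

/-- The open unit cube `Q = (0,1)ⁿ`. -/
def unitCube (n : ℕ) : Set (E n) := {x | ∀ i, x i ∈ Ioo (0 : ℝ) 1}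

/-- `φ ∈ C_c^∞(U)`, identified with its extension by zero to `ℝⁿ`. -/
structure IsTestFunction {n : ℕ} (U : Set (E n)) (φ : E n → ℝ) : Prop where
  smooth : ContDiff ℝ ∞ φ
  hasCompactSupport : HasCompactSupport φ
  tsupport_subset : tsupport φ ⊆ U

/-- The `j`-th row of a matrix field, as a vector field. -/
def row {m n : ℕ} (G : E n → Matrix (Fin m) (Fin n) ℝ) (j : Fin m) : E n → E n :=
  fun x => WithLp.toLp 2 (G x j)

/-- The `j`-th component of a vector-valued function. -/
def comp {m n : ℕ} (u : E n → E m) (j : Fin m) : E n → ℝ := fun x => u x j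

/-! ### Classical Sobolev functions -/

/-- `v` is (a version of) the weak gradient of `u : U → ℝ` on the open set `U`. -/
structure HasWeakGradient {n : ℕ} (U : Set (E n)) (u : E n → ℝ) (v : E n → E n) : Prop where
  locallyIntegrableOn : LocallyIntegrableOn u U volume
  locallyIntegrableOn_gradient : LocallyIntegrableOn v U volume
  integral_eq : ∀ φ : E n → ℝ, IsTestFunction U φ →
    ∫ x in U, φ x • v x = -∫ x in U, u x • gradient φ x

/-- `u ∈ W^{1,∞}(U)`. -/
def MemW1Infty {n : ℕ} (U : Set (E n)) (u : E n → ℝ) : Prop :=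
  MemLp u ⊤ (volume.restrict U) ∧
    ∃ v : E n → E n, HasWeakGradient U u v ∧ MemLp v ⊤ (volume.restrict U)

/-- Zero boundary values in the sense of the trace, for `u ∈ W^{1,∞}(U)` with `U` an open cube:
the trace of such a `u` is the restriction to the boundary of its representative that is
continuous up to the boundary. -/
def HasZeroTrace {n : ℕ} (U : Set (E n)) (u : E n → ℝ) : Prop :=
  ∃ w : E n → ℝ, ContinuousOn w (closure U) ∧ u =ᵐ[volume.restrict U] w ∧
    ∀ x ∈ frontier U, w x = 0

/-- `u ∈ W^{1,∞}_0(Q; ℝᵐ)`, componentwise. -/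
def MemW1InftyZero {m n : ℕ} (u : E n → E m) : Prop :=
  ∀ j, MemW1Infty (unitCube n) (comp u j) ∧ HasZeroTrace (unitCube n) (comp u j)

/-- `G = ∇u` on `Q` in the weak sense, row by row, for `u : Q → ℝᵐ`. -/
def HasWeakJacobian {m n : ℕ} (u : E n → E m) (G : E n → Matrix (Fin m) (Fin n) ℝ) : Prop :=
  ∀ j, HasWeakGradient (unitCube n) (comp u j) (row G j)

/-- Quasiconvexity in the sense of Morrey. The right-hand side of Jensen's inequality is required
to be a meaningful (finite) integral. -/
def IsQuasiconvex {m n : ℕ} (h : Matrix (Fin m) (Fin n) ℝ → ℝ) : Prop :=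
  ∀ (A : Matrix (Fin m) (Fin n) ℝ) (u : E n → E m) (G : E n → Matrix (Fin m) (Fin n) ℝ),
    MemW1InftyZero u → HasWeakJacobian u G →
      IntegrableOn (fun y => h (A + G y)) (unitCube n) volume ∧
        h A ≤ ∫ y in unitCube n, h (A + G y)

/-! ### Fractional Sobolev functions -/

/-- The constant `μ_{n,α} = 2^α π^{-n/2} Γ((n+α+1)/2) / Γ((1-α)/2)`. -/
def rieszConst (n : ℕ) (α : ℝ) : ℝ :=
  (2 : ℝ) ^ α * Real.pi ^ (-(n : ℝ) / 2) * Real.Gamma (((n : ℝ) + α + 1) / 2) /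
    Real.Gamma ((1 - α) / 2)

/-- The Riesz fractional gradient `∇^α φ` (used here for `φ ∈ C_c^∞(ℝⁿ)`, for which the integral
converges absolutely at every point `x`). -/
def rieszGradient {n : ℕ} (α : ℝ) (φ : E n → ℝ) (x : E n) : E n :=
  rieszConst n α •
    ∫ y, ((φ y - φ x) / ‖y - x‖ ^ ((n : ℝ) + α)) • (‖y - x‖⁻¹ • (y - x))

/-- `v` is (a version of) the weak `α`-fractional gradient of `u ∈ L¹(ℝⁿ) + L^∞(ℝⁿ)`. -/
structure HasWeakFracGradient {n : ℕ} (α : ℝ) (u : E n → ℝ) (v : E n → E n) : Prop where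
  mem_add : ∃ u₁ u₂ : E n → ℝ, MemLp u₁ 1 volume ∧ MemLp u₂ ⊤ volume ∧ u = u₁ + u₂
  locallyIntegrable : LocallyIntegrable v volume
  integral_eq : ∀ φ : E n → ℝ, IsTestFunction univ φ →
    ∫ x, φ x • v x = -∫ x, u x • rieszGradient α φ x

/-- `u ∈ S^{α,∞}(ℝⁿ)`. -/
def MemSInfty {n : ℕ} (α : ℝ) (u : E n → ℝ) : Prop :=
  MemLp u ⊤ volume ∧ ∃ v : E n → E n, HasWeakFracGradient α u v ∧ MemLp v ⊤ volume

/-- `u` is `Q`-periodic (as an element of `L^∞`, so almost everywhere). -/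
def IsQPeriodic {m n : ℕ} (u : E n → E m) : Prop :=
  ∀ i : Fin n, (fun x => u (x + EuclideanSpace.single i (1 : ℝ))) =ᵐ[volume] u

/-- `u ∈ S^{α,∞}_per(Q; ℝᵐ)`. -/
def MemSInftyPer {m n : ℕ} (α : ℝ) (u : E n → E m) : Prop :=
  (∀ j, MemSInfty α (comp u j)) ∧ IsQPeriodic u

/-- `G = ∇^α u` on `ℝⁿ` in the weak sense, row by row, for `u : ℝⁿ → ℝᵐ`. -/
def HasWeakFracJacobian {m n : ℕ} (α : ℝ) (u : E n → E m)
    (G : E n → Matrix (Fin m) (Fin n) ℝ) : Prop :=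
  ∀ j, HasWeakFracGradient α (comp u j) (row G j)

/-- `α`-quasiconvexity. As for quasiconvexity, the right-hand side of Jensen's inequality is
required to be a meaningful (finite) integral. -/
def IsAlphaQuasiconvex {m n : ℕ} (α : ℝ) (h : Matrix (Fin m) (Fin n) ℝ → ℝ) : Prop :=
  ∀ (A : Matrix (Fin m) (Fin n) ℝ) (u : E n → E m) (G : E n → Matrix (Fin m) (Fin n) ℝ),
    MemSInftyPer α u → HasWeakFracJacobian α u G →
      IntegrableOn (fun y => h (A + G y)) (unitCube n) volume ∧
        h A ≤ ∫ y in unitCube n, h (A + G y)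

end FracQC

end

/-! Operators of order `1 - α` turn classical gradients of periodic functions into fractional ones
and back, so both definitions test `h` on essentially the same fields.

From `α`-quasiconvexity to quasiconvexity. A function in `W^{1,∞}_0(Q)` extends periodically to a
bounded Lipschitz function `W` (`exists_periodic_lipschitz_extension`). A multiple `u` of its
fractional Laplacian of order `1 - α` is bounded and periodic, and `∇^α u = ∇W`
(`exists_fracPotential`), so the inequality for `u` is the one wanted. By duality, `∇^α u = ∇W`
reduces to the statement that the fractional Laplacian of `∇^α φ` is a nonzero multiple of `∇φ` for
test functions `φ` (`exists_diffOp_diffOp_eq`). This is read off Fourier symbols: scaling and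
rotation determine both symbols up to constants, and of these it matters only that their product is
nonzero and purely imaginary.

From quasiconvexity to `α`-quasiconvexity. For `u` in `S^{α,∞}_per`, the Riesz potential `V` of
order `1 - α`, with kernel normalised at `0` so that it converges for bounded `u`, satisfies `∇V =
∇^α u` weakly. Hence `V` is Lipschitz. It is periodic because its increment over a period is
constant, while `V` grows at most like `‖x‖ ^ (1 - α)` (`rieszPotential_periodic`). It remains to
pass from zero boundary values to periodic functions (`IsQuasiconvex.le_setIntegral_periodic`):
rescale `V` to oscillate with integer frequency, cut it off near the boundary of the cube, and let
the frequency tend to infinity. The error lives in a vanishing boundary layer and is controlled by a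
bound for `h` on bounded sets. That bound comes from the requirement that the integrals in the
definition of quasiconvexity be finite (`IsQuasiconvex.exists_bound`); continuity of `h` plays no
role. -/

namespace FracQC

open Filter Topology Metric
open scoped FourierTransform

variable {n : ℕ}

/-! ### Test functions and gradients -/

theorem IsTestFunction.continuous {U : Set (E n)} {φ : E n → ℝ} (h : IsTestFunction U φ) :
    Continuous φ := h.smooth.continuous

theorem IsTestFunction.mono {U V : Set (E n)} {φ : E n → ℝ} (h : IsTestFunction U φ)
    (hUV : U ⊆ V) : IsTestFunction V φ :=
  ⟨h.smooth, h.hasCompactSupport, h.tsupport_subset.trans hUV⟩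

theorem IsTestFunction.eq_zero_of_notMem {U : Set (E n)} {φ : E n → ℝ} (h : IsTestFunction U φ)
    {x : E n} (hx : x ∉ U) : φ x = 0 :=
  image_eq_zero_of_notMem_tsupport fun h' => hx (h.tsupport_subset h')

theorem IsTestFunction.exists_lipschitzWith {U : Set (E n)} {φ : E n → ℝ}
    (h : IsTestFunction U φ) : ∃ C, LipschitzWith C φ :=
  ContDiff.lipschitzWith_of_hasCompactSupport h.hasCompactSupport (h.smooth.of_le (by simp))
    one_ne_zero

theorem inner_gradient_eq_fderiv (f : E n → ℝ) (x e : E n) :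
    inner ℝ (gradient f x) e = fderiv ℝ f x e := by
  rw [← toDual_gradient (𝕜 := ℝ) (f := f), InnerProductSpace.toDual_apply_apply]

theorem norm_gradient_eq (f : E n → ℝ) (x : E n) : ‖gradient f x‖ = ‖fderiv ℝ f x‖ := by
  rw [gradient, LinearIsometryEquiv.norm_map]

theorem norm_gradient_le_of_lipschitzWith {f : E n → ℝ} {K : NNReal} (hf : LipschitzWith K f)
    (x : E n) : ‖gradient f x‖ ≤ K := by
  rw [norm_gradient_eq]; exact norm_fderiv_le_of_lipschitz ℝ hf

theorem measurable_gradient (f : E n → ℝ) : Measurable (gradient f) :=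
  (InnerProductSpace.toDual ℝ (E n)).symm.continuous.measurable.comp (measurable_fderiv ℝ f)

theorem memLp_top_gradient {f : E n → ℝ} {K : NNReal} (hf : LipschitzWith K f)
    (μ : Measure (E n)) : MemLp (gradient f) ⊤ μ :=
  memLp_top_of_bound (measurable_gradient f).aestronglyMeasurable K
    (.of_forall fun x => norm_gradient_le_of_lipschitzWith hf x)

theorem continuous_gradient {f : E n → ℝ} (hf : ContDiff ℝ 1 f) : Continuous (gradient f) :=
  (InnerProductSpace.toDual ℝ (E n)).symm.continuous.comp (hf.continuous_fderiv one_ne_zero)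

theorem IsTestFunction.continuous_gradient {U : Set (E n)} {φ : E n → ℝ}
    (h : IsTestFunction U φ) : Continuous (gradient φ) :=
  FracQC.continuous_gradient (h.smooth.of_le (by simp))

theorem gradient_eq_zero_of_notMem_tsupport {φ : E n → ℝ} {x : E n} (hx : x ∉ tsupport φ) :
    gradient φ x = 0 := by
  rw [gradient, image_eq_zero_of_notMem_tsupport (f := fderiv ℝ φ)
    fun h => hx (tsupport_fderiv_subset ℝ h), map_zero]

theorem IsTestFunction.gradient_eq_zero_of_notMem {U : Set (E n)} {φ : E n → ℝ}
    (h : IsTestFunction U φ) {x : E n} (hx : x ∉ U) : gradient φ x = 0 :=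
  gradient_eq_zero_of_notMem_tsupport fun h' => hx (h.tsupport_subset h')

theorem IsTestFunction.integrable_smul {F : Type*} [NormedAddCommGroup F] [NormedSpace ℝ F]
    {U : Set (E n)} {φ : E n → ℝ} (h : IsTestFunction U φ)
    {v : E n → F} (hv : LocallyIntegrableOn v U volume) :
    Integrable (fun x => φ x • v x) := by
  have h1 : IntegrableOn (fun x => φ x • v x) (tsupport φ) := by
    have := hv.integrableOn_compact_subset h.tsupport_subset h.hasCompactSupport
    exact this.continuousOn_smul h.continuous.continuousOn h.hasCompactSupport
  refine (integrableOn_iff_integrable_of_support_subset fun x hx => subset_tsupport φ ?_).1 h1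
  rw [Function.mem_support] at hx ⊢
  exact fun h0 => hx (by rw [h0, zero_smul])

theorem IsTestFunction.integrable_smul_gradient {U : Set (E n)} {φ : E n → ℝ}
    (h : IsTestFunction U φ) {u : E n → ℝ} (hu : LocallyIntegrableOn u U volume) :
    Integrable (fun x => u x • gradient φ x) := by
  have h1 : IntegrableOn (fun x => u x • gradient φ x) (tsupport φ) := by
    have := hu.integrableOn_compact_subset h.tsupport_subset h.hasCompactSupport
    exact this.smul_continuousOn h.continuous_gradient.continuousOn h.hasCompactSupport
  refine (integrableOn_iff_integrable_of_support_subset fun x hx => ?_).1 h1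
  by_contra h0
  rw [Function.mem_support, gradient_eq_zero_of_notMem_tsupport h0, smul_zero] at hx
  exact hx rfl

theorem IsTestFunction.comp_sub_right {φ : E n → ℝ} (h : IsTestFunction univ φ) (a : E n) :
    IsTestFunction univ (fun x => φ (x - a)) where
  smooth := h.smooth.comp (contDiff_id.sub contDiff_const)
  hasCompactSupport := h.hasCompactSupport.comp_homeomorph (Homeomorph.subRight a)
  tsupport_subset := subset_univ _

theorem gradient_comp_add_right (φ : E n → ℝ) (a x : E n) :
    gradient (fun x => φ (x + a)) x = gradient φ (x + a) := by
  rw [gradient, gradient, fderiv_comp_add_right]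

/-- The vector identity defining a weak gradient, tested against a fixed direction. -/
theorem integral_smul_eq_iff_inner {U : Set (E n)} {φ : E n → ℝ} (h : IsTestFunction U φ)
    {u : E n → ℝ} {v : E n → E n} (hu : LocallyIntegrableOn u U volume)
    (hv : LocallyIntegrableOn v U volume) :
    (∫ x in U, φ x • v x = -∫ x in U, u x • gradient φ x) ↔
      ∀ e : E n, ∫ x in U, φ x * inner ℝ e (v x) = -∫ x in U, u x * fderiv ℝ φ x e := by
  have key1 : ∀ e, ∫ x in U, φ x * inner ℝ e (v x) = inner ℝ e (∫ x in U, φ x • v x) := fun e => by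
    rw [← integral_inner (h.integrable_smul hv).integrableOn]
    simp [inner_smul_right]
  have key2 : ∀ e, ∫ x in U, u x * fderiv ℝ φ x e = inner ℝ e (∫ x in U, u x • gradient φ x) :=
    fun e => by
      rw [← integral_inner (h.integrable_smul_gradient hu).integrableOn]
      simp only [inner_smul_right, ← inner_gradient_eq_fderiv, real_inner_comm]
  constructor
  · intro H e
    rw [key1, key2, H, inner_neg_right]
  · intro H
    refine ext_inner_left ℝ fun e => ?_
    rw [inner_neg_right, ← key1, ← key2, H]

/-! ### Weak gradients -/

theorem setIntegral_smul_test {F : Type*} [NormedAddCommGroup F] [NormedSpace ℝ F]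
    {U : Set (E n)} {φ : E n → ℝ} (h : IsTestFunction U φ) (v : E n → F) :
    ∫ x in U, φ x • v x = ∫ x, φ x • v x :=
  setIntegral_eq_integral_of_forall_compl_eq_zero fun x hx => by
    rw [h.eq_zero_of_notMem hx, zero_smul]

theorem setIntegral_smul_gradient_test {U : Set (E n)} {φ : E n → ℝ} (h : IsTestFunction U φ)
    (u : E n → ℝ) : ∫ x in U, u x • gradient φ x = ∫ x, u x • gradient φ x :=
  setIntegral_eq_integral_of_forall_compl_eq_zero fun x hx => by
    rw [h.gradient_eq_zero_of_notMem hx, smul_zero]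

theorem HasWeakGradient.mono {U V : Set (E n)} {u : E n → ℝ} {v : E n → E n}
    (h : HasWeakGradient V u v) (hUV : U ⊆ V) : HasWeakGradient U u v where
  locallyIntegrableOn := h.locallyIntegrableOn.mono_set hUV
  locallyIntegrableOn_gradient := h.locallyIntegrableOn_gradient.mono_set hUV
  integral_eq φ hφ := by
    have := h.integral_eq φ (hφ.mono hUV)
    rw [setIntegral_smul_test (hφ.mono hUV), setIntegral_smul_gradient_test (hφ.mono hUV)] at this
    rw [setIntegral_smul_test hφ, setIntegral_smul_gradient_test hφ, this]

theorem HasWeakGradient.congr {U : Set (E n)} {u u' : E n → ℝ} {v v' : E n → E n}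
    (h : HasWeakGradient U u v) (hu : u =ᵐ[volume.restrict U] u')
    (hv : v =ᵐ[volume.restrict U] v') : HasWeakGradient U u' v' where
  locallyIntegrableOn x hx := by
    obtain ⟨s, hs, hi⟩ := h.locallyIntegrableOn x hx
    exact ⟨s ∩ U, inter_mem hs self_mem_nhdsWithin, (hi.mono_set inter_subset_left).congr
      (ae_mono (Measure.restrict_mono inter_subset_right le_rfl) hu)⟩
  locallyIntegrableOn_gradient x hx := by
    obtain ⟨s, hs, hi⟩ := h.locallyIntegrableOn_gradient x hx
    exact ⟨s ∩ U, inter_mem hs self_mem_nhdsWithin, (hi.mono_set inter_subset_left).congr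
      (ae_mono (Measure.restrict_mono inter_subset_right le_rfl) hv)⟩
  integral_eq φ hφ := by
    have := h.integral_eq φ hφ
    rw [integral_congr_ae (g := fun x => φ x • v' x) (hv.mono fun x hx => by simp only [hx]),
      integral_congr_ae (f := fun x => u x • gradient φ x) (g := fun x => u' x • gradient φ x)
        (hu.mono fun x hx => by simp only [hx])] at this
    exact this

/-- Rademacher: a Lipschitz function has its pointwise gradient as weak gradient. -/
theorem hasWeakGradient_of_lipschitzWith {f : E n → ℝ} {K : NNReal} (hf : LipschitzWith K f)
    (U : Set (E n)) : HasWeakGradient U f (gradient f) := by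
  refine HasWeakGradient.mono (V := univ) ?_ (subset_univ _)
  have h1 : LocallyIntegrableOn f univ volume := hf.continuous.locallyIntegrable.locallyIntegrableOn _
  have h2 : LocallyIntegrableOn (gradient f) univ volume :=
    ((memLp_top_gradient hf volume).locallyIntegrable le_top).locallyIntegrableOn _
  refine ⟨h1, h2, fun φ hφ => (integral_smul_eq_iff_inner hφ h1 h2).2 fun e => ?_⟩
  obtain ⟨D, hD⟩ := hφ.exists_lipschitzWith
  have := hf.integral_lineDeriv_mul_eq (μ := volume) hD hφ.hasCompactSupport e
  rw [setIntegral_univ, setIntegral_univ, ← integral_neg]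
  calc ∫ x, φ x * inner ℝ e (gradient f x) = ∫ x, lineDeriv ℝ f x e * φ x := by
        refine integral_congr_ae ?_
        filter_upwards [hf.ae_differentiableAt (μ := volume)] with x hx
        rw [hx.lineDeriv_eq_fderiv, real_inner_comm, inner_gradient_eq_fderiv, mul_comm]
    _ = ∫ x, lineDeriv ℝ φ x (-e) * f x := this
    _ = _ := by
        congr 1 with x
        have hd : DifferentiableAt ℝ φ x := (hφ.smooth.differentiable (by simp)).differentiableAt
        rw [hd.lineDeriv_eq_fderiv, map_neg]; ring

theorem HasWeakGradient.ae_eq {U : Set (E n)} (hU : IsOpen U) {u : E n → ℝ} {v v' : E n → E n}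
    (h : HasWeakGradient U u v) (h' : HasWeakGradient U u v') : v =ᵐ[volume.restrict U] v' := by
  have := hU.ae_eq_zero_of_integral_contDiff_smul_eq_zero (μ := volume) (f := v - v')
    (h.locallyIntegrableOn_gradient.sub h'.locallyIntegrableOn_gradient) ?_
  · rw [EventuallyEq, ae_restrict_iff' hU.measurableSet]
    filter_upwards [this] with x hx hxU
    exact sub_eq_zero.1 (hx hxU)
  · intro φ h1 h2 h3
    have hφ : IsTestFunction U φ := ⟨h1, h2, h3⟩
    simp only [Pi.sub_apply, smul_sub]
    rw [integral_sub (hφ.integrable_smul h.locallyIntegrableOn_gradient)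
      (hφ.integrable_smul h'.locallyIntegrableOn_gradient), ← setIntegral_smul_test hφ,
      ← setIntegral_smul_test hφ, h.integral_eq φ hφ, h'.integral_eq φ hφ, sub_self]

/-! ### Mollification, and Lipschitz continuity from a bounded weak gradient -/

open scoped Convolution in
-- The derivative is put on `ρ`, so that the integral becomes a weak gradient tested against a
-- reflected translate of `ρ`.
theorem hasFDerivAt_mollification {w : E n → ℝ} (hw : LocallyIntegrable w volume)
    {ρ : E n → ℝ} (hρ : ContDiff ℝ ∞ ρ) (hc : HasCompactSupport ρ) (x : E n) :
    ∃ D : E n →L[ℝ] ℝ, HasFDerivAt (ρ ⋆[ContinuousLinearMap.lsmul ℝ ℝ] w) D x ∧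
      ∀ e, D e = ∫ t, w t * fderiv ℝ ρ (x - t) e := by
  have hρ1 : ContDiff ℝ 1 ρ := hρ.of_le (by simp)
  have h := hc.hasFDerivAt_convolution_right (ContinuousLinearMap.lsmul ℝ ℝ) hw hρ1 x
  have he : ρ ⋆[ContinuousLinearMap.lsmul ℝ ℝ] w = w ⋆[ContinuousLinearMap.lsmul ℝ ℝ] ρ := by
    ext y
    rw [convolution_eq_swap, convolution_def]
    simp [mul_comm]
  refine ⟨_, he ▸ h, fun e => ?_⟩
  rw [convolution_precompR_apply _ hw (hc.fderiv ℝ) (hρ1.continuous_fderiv one_ne_zero),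
    convolution_def]
  simp

/-- A function on a convex open set that is continuous and has a bounded weak gradient is
Lipschitz. -/
theorem HasWeakGradient.lipschitzOnWith {U : Set (E n)} (hU : IsOpen U) (hconv : Convex ℝ U)
    {w : E n → ℝ} {v : E n → E n} {L : NNReal} (hw : LocallyIntegrable w volume)
    (hwc : ContinuousOn w U) (h : HasWeakGradient U w v)
    (hL : ∀ᵐ x ∂volume.restrict U, ‖v x‖ ≤ L) : LipschitzOnWith L w U := by
  refine LipschitzOnWith.of_dist_le_mul fun x hx y hy => ?_
  have hK : IsCompact (segment ℝ x y) := by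
    rw [segment_eq_image ℝ x y]
    exact isCompact_Icc.image (by fun_prop)
  -- Bumps of radius at most `δ` centred on the segment are supported in `U`, hence admissible in
  -- the weak gradient identity. The Lipschitz bound is proved for the mollifications along the
  -- segment and survives the limit.
  obtain ⟨δ, hδ, hδU⟩ := hK.exists_cthickening_subset_open hU (hconv.segment_subset hx hy)
  let ρ : ℕ → ContDiffBump (0 : E n) := fun k =>
    ⟨δ / (2 * (k + 1)), δ / (k + 1), by positivity, by
      apply div_lt_div_of_pos_left hδ (by positivity) (by linarith [(Nat.cast_nonneg k : (0 : ℝ) ≤ k)])⟩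
  have hρ0 : Tendsto (fun k => (ρ k).rOut) atTop (𝓝 0) := by
    have := (tendsto_one_div_add_atTop_nhds_zero_nat (𝕜 := ℝ)).const_mul δ
    simpa only [ρ, mul_one_div, mul_zero] using this
  have hρδ : ∀ k, (ρ k).rOut ≤ δ := fun k => by
    apply div_le_self hδ.le; linarith [(Nat.cast_nonneg k : (0 : ℝ) ≤ k)]
  let g : ℕ → E n → ℝ := fun k =>
    convolution ((ρ k).normed volume) w (ContinuousLinearMap.lsmul ℝ ℝ) volume
  have hlim : ∀ z ∈ U, Tendsto (fun k => g k z) atTop (𝓝 (w z)) := fun z hz =>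
    ContDiffBump.convolution_tendsto_right hρ0
      (Eventually.of_forall fun _ => hw.aestronglyMeasurable)
      (((hwc.continuousAt (hU.mem_nhds hz)).tendsto).comp tendsto_snd) tendsto_const_nhds
  have hg : ∀ k, ‖g k y - g k x‖ ≤ L * ‖y - x‖ := by
    intro k
    have hsm : ContDiff ℝ ∞ ((ρ k).normed (volume : Measure (E n))) := (ρ k).contDiff_normed
    have hcs : HasCompactSupport ((ρ k).normed (volume : Measure (E n))) :=
      (ρ k).hasCompactSupport_normed
    choose D hD hDe using fun z => hasFDerivAt_mollification hw hsm hcs z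
    refine (convex_segment x y).norm_image_sub_le_of_norm_hasFDerivWithin_le (𝕜 := ℝ) (f' := D)
      (fun z _ => (hD z).hasFDerivWithinAt) (fun z hz => ?_) (left_mem_segment ℝ x y)
      (right_mem_segment ℝ x y)
    refine ContinuousLinearMap.opNorm_le_bound _ L.coe_nonneg fun e => ?_
    set φ : E n → ℝ := fun t => (ρ k).normed volume (z - t) with hφdef
    have hφ : IsTestFunction U φ := by
      refine ⟨hsm.comp (contDiff_const.sub contDiff_id),
        hcs.comp_homeomorph (Homeomorph.subLeft z), ?_⟩
      refine (closure_minimal ?_ isClosed_closedBall : _ ⊆ closedBall z δ).trans fun t ht =>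
        hδU (mem_cthickening_of_dist_le t z δ _ hz ht)
      intro t ht
      have h1 : z - t ∈ Function.support ((ρ k).normed (volume : Measure (E n))) := ht
      rw [ContDiffBump.support_normed_eq, mem_ball_zero_iff] at h1
      rw [mem_closedBall, dist_comm, dist_eq_norm]
      exact h1.le.trans (hρδ k)
    have hfd : ∀ t, fderiv ℝ φ t e = -fderiv ℝ ((ρ k).normed volume) (z - t) e := fun t => by
      have h1 : HasFDerivAt φ ((fderiv ℝ ((ρ k).normed volume) (z - t)).comp
          (-ContinuousLinearMap.id ℝ (E n))) t :=
        HasFDerivAt.comp t ((hsm.differentiable (by simp)).differentiableAt.hasFDerivAt)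
          ((hasFDerivAt_id t).const_sub z)
      rw [h1.fderiv]; simp
    -- The sign produced by differentiating `z - t` cancels the sign in the definition of the weak
    -- gradient.
    have heq : D z e = ∫ t in U, φ t * inner ℝ e (v t) := by
      rw [(integral_smul_eq_iff_inner hφ h.locallyIntegrableOn h.locallyIntegrableOn_gradient).1
        (h.integral_eq φ hφ) e, hDe, ← integral_neg]
      rw [setIntegral_eq_integral_of_forall_compl_eq_zero]
      · congr 1 with t; rw [hfd]; ring
      · intro t ht
        rw [← inner_gradient_eq_fderiv, hφ.gradient_eq_zero_of_notMem ht]; simp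
    rw [heq]
    have hφi : Integrable φ := hφ.continuous.integrable_of_hasCompactSupport hφ.hasCompactSupport
    have hφ0 : ∀ t, 0 ≤ φ t := fun t => (ρ k).nonneg_normed _
    calc ‖∫ t in U, φ t * inner ℝ e (v t)‖ ≤ ∫ t in U, φ t * (L * ‖e‖) := by
          refine norm_integral_le_of_norm_le (hφi.integrableOn.mul_const _) ?_
          filter_upwards [hL] with t ht
          rw [norm_mul, Real.norm_of_nonneg (hφ0 t)]
          gcongr
          · exact hφ0 t
          · exact (norm_inner_le_norm e (v t)).trans (by
              rw [mul_comm]; gcongr)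
      _ = (∫ t in U, φ t) * (L * ‖e‖) := integral_mul_const _ _
      _ ≤ (∫ t, φ t) * (L * ‖e‖) := by
          gcongr
          · exact Eventually.of_forall hφ0
          · exact Measure.restrict_le_self
      _ = L * ‖e‖ := by
          have : ∫ t, φ t = 1 := by
            rw [hφdef, integral_sub_left_eq_self]; exact (ρ k).integral_normed
          rw [this, one_mul]
  have := le_of_tendsto (((hlim y hy).sub (hlim x hx)).norm) (Eventually.of_forall hg)
  rw [dist_comm, dist_comm x y, dist_eq_norm, dist_eq_norm]
  exact this

theorem HasWeakGradient.lipschitzWith {w : E n → ℝ} {v : E n → E n} {L : NNReal}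
    (hwc : Continuous w) (h : HasWeakGradient univ w v) (hL : ∀ᵐ x, ‖v x‖ ≤ L) :
    LipschitzWith L w := by
  rw [← lipschitzOnWith_univ]
  exact h.lipschitzOnWith isOpen_univ convex_univ hwc.locallyIntegrable hwc.continuousOn
    (by rwa [Measure.restrict_univ])

instance [NeZero n] : Nontrivial (E n) :=
  Module.nontrivial_of_finrank_pos (R := ℝ) (by
    rw [finrank_euclideanSpace_fin]; exact Nat.pos_of_ne_zero (NeZero.ne n))

/-! ### Integrability of radial powers -/

/-- The first factor is the Jacobian of polar coordinates. -/
theorem rpow_dim_mul [NeZero n] {y : ℝ} (hy : 0 < y) (p : ℝ) :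
    y ^ (Module.finrank ℝ (E n) - 1) * y ^ p = y ^ (p + n - 1) := by
  rw [finrank_euclideanSpace_fin, ← Real.rpow_natCast, ← Real.rpow_add hy,
    Nat.cast_sub (Nat.pos_of_ne_zero (NeZero.ne n))]
  congr 1; push_cast; ring

theorem integrableOn_ball_norm_rpow [NeZero n] {p : ℝ} (hp : -(n : ℝ) < p) (R : ℝ) :
    IntegrableOn (fun z : E n => ‖z‖ ^ p) (ball 0 R) := by
  refine (integrableOn_fun_norm_addHaar volume (f := fun y => y ^ p)).2 ?_
  have h : IntegrableOn (fun y : ℝ => y ^ (p + n - 1)) (Ioo 0 R) := by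
    rcases le_or_gt R 0 with hR | hR
    · simp [Ioo_eq_empty_of_le hR]
    · exact (intervalIntegral.integrableOn_Ioo_rpow_iff hR).2 (by linarith)
  refine h.congr_fun (fun y hy => ?_) measurableSet_Ioo
  rw [smul_eq_mul, rpow_dim_mul hy.1]

theorem integrable_indicator_norm_rpow [NeZero n] {p R : ℝ} (hp : p < -(n : ℝ)) (hR : 0 < R) :
    Integrable (fun z : E n => (Ioi R).indicator (fun y : ℝ => y ^ p) ‖z‖) := by
  refine (integrable_fun_norm_addHaar volume (f := (Ioi R).indicator fun y => y ^ p)).2 ?_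
  have h : IntegrableOn (fun y : ℝ => y ^ (p + n - 1)) (Ioi R) :=
    integrableOn_Ioi_rpow_of_lt (by linarith) hR
  rw [← integrable_indicator_iff measurableSet_Ioi] at h
  refine h.integrableOn.congr_fun (fun y hy => ?_) measurableSet_Ioi
  by_cases hyR : R < y
  · rw [indicator_of_mem (mem_Ioi.2 hyR), indicator_of_mem (mem_Ioi.2 hyR), smul_eq_mul,
      rpow_dim_mul hy]
  · rw [indicator_of_notMem (by simpa using hyR), indicator_of_notMem (by simpa using hyR),
      smul_zero]

/-- The weight `min(1,|z|) |z|^{-n-β}`. -/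
noncomputable def singWeight (n : ℕ) (β : ℝ) (z : E n) : ℝ := min 1 ‖z‖ * ‖z‖ ^ (-(n + β))

theorem singWeight_nonneg (β : ℝ) (z : E n) : 0 ≤ singWeight n β z := by
  unfold singWeight; positivity

theorem measurable_singWeight (β : ℝ) : Measurable (singWeight n β) := by
  unfold singWeight; fun_prop

/-- Near the origin the weight is `‖z‖ ^ (1 - n - β)`, integrable because `β < 1`; at infinity it is
`‖z‖ ^ (-n - β)`, integrable because `0 < β`. The convergence of the operators `diffOp` rests on
this weight. -/
theorem integrable_singWeight [NeZero n] {β : ℝ} (h0 : 0 < β) (h1 : β < 1) :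
    Integrable (singWeight n β) := by
  have hA := (integrableOn_ball_norm_rpow (n := n) (p := 1 - (n + β)) (by linarith) 2)
  have hB := integrable_indicator_norm_rpow (n := n) (p := -(n + β)) (R := 1) (by linarith) one_pos
  rw [← integrable_indicator_iff measurableSet_ball] at hA
  refine (hA.add hB).mono' (measurable_singWeight β).aestronglyMeasurable
    (Eventually.of_forall fun z => ?_)
  rw [Real.norm_of_nonneg (singWeight_nonneg β z), Pi.add_apply, singWeight]
  have hn1 : 0 ≤ (ball (0 : E n) 2).indicator (fun z => ‖z‖ ^ (1 - (n + β))) z :=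
    indicator_nonneg (fun z _ => by positivity) z
  have hn2 : 0 ≤ (Ioi (1 : ℝ)).indicator (fun y : ℝ => y ^ (-(n + β))) ‖z‖ :=
    indicator_nonneg (fun y hy => by have : (0 : ℝ) < y := one_pos.trans hy; positivity) _
  rcases le_or_gt ‖z‖ 1 with h | h
  · refine le_trans ?_ (le_add_of_nonneg_right hn2)
    rw [indicator_of_mem (by rw [mem_ball_zero_iff]; linarith), min_eq_right h]
    rcases eq_or_ne z 0 with rfl | hz
    · simp only [norm_zero, zero_mul]; positivity
    · have : 0 < ‖z‖ := norm_pos_iff.2 hz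
      rw [sub_eq_add_neg, Real.rpow_add this, Real.rpow_one]
  · refine le_trans ?_ (le_add_of_nonneg_left hn1)
    rw [indicator_of_mem (mem_Ioi.2 h), min_eq_left h.le, one_mul]

/-! ### Difference operators with singular kernels -/

/-- A kernel of order `β`. -/
structure IsKernel (β : ℝ) (κ : E n → ℝ) : Prop where
  measurable : Measurable κ
  exists_bound : ∃ B, 0 ≤ B ∧ ∀ z, |κ z| ≤ B * ‖z‖ ^ (-(n + β))

/-- The translations of `g` are bounded in `L¹`, to first order near zero. -/
structure L1Lipschitz {F : Type*} [NormedAddCommGroup F] (C : ℝ) (g : E n → F) : Prop where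
  integrable : Integrable g
  bound : ∀ z, ∫ x, ‖g (x + z) - g x‖ ≤ C * min 1 ‖z‖

/-- The translations of `g` are bounded in `L^∞`, to first order near zero. -/
structure SupLipschitz {F : Type*} [NormedAddCommGroup F] (C : ℝ) (g : E n → F) : Prop where
  continuous : Continuous g
  bound : ∀ x z, ‖g (x + z) - g x‖ ≤ C * min 1 ‖z‖

/-- The operator `g ↦ ∫ κ(z) (g(x+z) - g(x)) dz`. -/
noncomputable def diffOp {F : Type*} [NormedAddCommGroup F] [NormedSpace ℝ F] (κ : E n → ℝ) (g : E n → F)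
    (x : E n) : F := ∫ z, κ z • (g (x + z) - g x)

section

variable {F : Type*} [NormedAddCommGroup F] {C : ℝ} {g : E n → F}

theorem SupLipschitz.nonneg [NeZero n] (h : SupLipschitz C g) : 0 ≤ C := by
  obtain ⟨z, hz⟩ := exists_ne (0 : E n)
  have hz : 0 < min 1 ‖z‖ := lt_min one_pos (norm_pos_iff.2 hz)
  exact nonneg_of_mul_nonneg_left ((norm_nonneg _).trans (h.bound 0 z)) hz

theorem L1Lipschitz.integrable_diff (h : L1Lipschitz C g) (z : E n) :
    Integrable (fun x => g (x + z) - g x) :=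
  (h.integrable.comp_add_right z).sub h.integrable

variable [NormedSpace ℝ F] {β : ℝ} {κ : E n → ℝ}

theorem SupLipschitz.norm_smul_le [NeZero n] (h : SupLipschitz C g) {B : ℝ}
    (hB : ∀ z, |κ z| ≤ B * ‖z‖ ^ (-(n + β))) (x z : E n) :
    ‖κ z • (g (x + z) - g x)‖ ≤ B * C * singWeight n β z := by
  rw [norm_smul, Real.norm_eq_abs]
  refine (mul_le_mul (hB z) (h.bound x z) (norm_nonneg _) ((abs_nonneg _).trans (hB z))).trans
    (le_of_eq ?_)
  unfold singWeight; ring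

theorem SupLipschitz.integrable [NeZero n] (h : SupLipschitz C g) (h0 : 0 < β) (h1 : β < 1)
    (hκ : IsKernel β κ) (x : E n) : Integrable (fun z => κ z • (g (x + z) - g x)) := by
  obtain ⟨B, hB0, hB⟩ := hκ.exists_bound
  have hc := h.continuous
  refine ((integrable_singWeight h0 h1).const_mul (B * C)).mono' ?_
    (Eventually.of_forall fun z => h.norm_smul_le hB x z)
  exact hκ.measurable.aestronglyMeasurable.smul
    (Continuous.aestronglyMeasurable (by fun_prop))

theorem SupLipschitz.continuous_diffOp [NeZero n] (h : SupLipschitz C g) (h0 : 0 < β)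
    (h1 : β < 1) (hκ : IsKernel β κ) : Continuous (diffOp κ g) := by
  obtain ⟨B, hB0, hB⟩ := hκ.exists_bound
  have hc := h.continuous
  refine continuous_of_dominated (bound := fun z => B * C * singWeight n β z) (fun x => ?_)
    (fun x => Eventually.of_forall fun z => h.norm_smul_le hB x z)
    ((integrable_singWeight h0 h1).const_mul (B * C)) (Eventually.of_forall fun z => ?_)
  · exact (h.integrable h0 h1 hκ x).aestronglyMeasurable
  · fun_prop

theorem SupLipschitz.exists_norm_diffOp_le [NeZero n] (h : SupLipschitz C g) (h0 : 0 < β)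
    (h1 : β < 1) (hκ : IsKernel β κ) : ∃ M, ∀ x, ‖diffOp κ g x‖ ≤ M := by
  obtain ⟨B, hB0, hB⟩ := hκ.exists_bound
  refine ⟨∫ z, B * C * singWeight n β z, fun x => ?_⟩
  exact norm_integral_le_of_norm_le ((integrable_singWeight h0 h1).const_mul (B * C))
    (Eventually.of_forall fun z => h.norm_smul_le hB x z)

theorem aestronglyMeasurable_diff_prod (hg : AEStronglyMeasurable g) (hκ : Measurable κ) :
    AEStronglyMeasurable (fun p : E n × E n => κ p.2 • (g (p.1 + p.2) - g p.1))
      (volume.prod volume) := by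
  refine (hκ.comp measurable_snd).aestronglyMeasurable.smul (AEStronglyMeasurable.sub ?_ ?_)
  · exact hg.comp_quasiMeasurePreserving (quasiMeasurePreserving_add volume volume)
  · exact hg.comp_fst

/-- Integrating in `x` first, the kernel bound times the `L¹` modulus of `g` is a multiple of
`singWeight`. This licenses the applications of Fubini to `diffOp`. -/
theorem L1Lipschitz.integrable_prod [NeZero n] (h : L1Lipschitz C g) (h0 : 0 < β) (h1 : β < 1)
    (hκ : IsKernel β κ) :
    Integrable (fun p : E n × E n => κ p.2 • (g (p.1 + p.2) - g p.1)) (volume.prod volume) := by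
  obtain ⟨B, hB0, hB⟩ := hκ.exists_bound
  have hm := aestronglyMeasurable_diff_prod h.integrable.aestronglyMeasurable hκ.measurable
  rw [integrable_prod_iff' hm]
  refine ⟨Eventually.of_forall fun z => (h.integrable_diff z).smul (κ z), ?_⟩
  refine ((integrable_singWeight h0 h1).const_mul (B * C)).mono' hm.norm.prod_swap.integral_prod_right'
    (Eventually.of_forall fun z => ?_)
  rw [Real.norm_of_nonneg (integral_nonneg fun _ => norm_nonneg _)]
  simp only [norm_smul, integral_const_mul, Real.norm_eq_abs]
  refine (mul_le_mul (hB z) (h.bound z) (integral_nonneg fun _ => norm_nonneg _)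
    ((abs_nonneg _).trans (hB z))).trans (le_of_eq ?_)
  unfold singWeight; ring

theorem L1Lipschitz.integrable_diffOp [NeZero n] (h : L1Lipschitz C g) (h0 : 0 < β) (h1 : β < 1)
    (hκ : IsKernel β κ) : Integrable (diffOp κ g) :=
  (h.integrable_prod h0 h1 hκ).integral_prod_left

theorem L1Lipschitz.integral_norm_diffOp_le [NeZero n] (h : L1Lipschitz C g) (h0 : 0 < β)
    (h1 : β < 1) (hκ : IsKernel β κ) {B : ℝ} (hB : ∀ z, |κ z| ≤ B * ‖z‖ ^ (-(n + β))) :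
    ∫ x, ‖diffOp κ g x‖ ≤ B * C * ∫ z, singWeight n β z := by
  have hi := (h.integrable_prod h0 h1 hκ).norm
  calc ∫ x, ‖diffOp κ g x‖ ≤ ∫ x, ∫ z, ‖κ z • (g (x + z) - g x)‖ :=
        integral_mono (h.integrable_diffOp h0 h1 hκ).norm hi.integral_prod_left
          fun x => norm_integral_le_integral_norm _
    _ = ∫ z, ∫ x, ‖κ z • (g (x + z) - g x)‖ := integral_integral_swap hi
    _ ≤ ∫ z, B * C * singWeight n β z := by
        refine integral_mono hi.integral_prod_right
          ((integrable_singWeight h0 h1).const_mul _) fun z => ?_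
        simp only [norm_smul, integral_const_mul, Real.norm_eq_abs]
        refine (mul_le_mul (hB z) (h.bound z) (integral_nonneg fun _ => norm_nonneg _)
          ((abs_nonneg _).trans (hB z))).trans (le_of_eq ?_)
        unfold singWeight; ring
    _ = _ := integral_const_mul _ _

end

/-- Symmetry of difference operators with even kernels. -/
theorem integral_diffOp_mul [NeZero n] {β : ℝ} (h0 : 0 < β) (h1 : β < 1) {κ : E n → ℝ}
    (hκ : IsKernel β κ) (heven : ∀ z, κ (-z) = κ z) {C D M : ℝ} {v f : E n → ℝ}
    (hv : SupLipschitz C v) (hvM : ∀ x, |v x| ≤ M) (hf : L1Lipschitz D f) :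
    ∫ x, diffOp κ v x * f x = ∫ x, v x * diffOp κ f x := by
  obtain ⟨B, hB0, hB⟩ := hκ.exists_bound
  have hm := aestronglyMeasurable_diff_prod
    hv.continuous.aestronglyMeasurable hκ.measurable
  have hi1 : Integrable (fun p : E n × E n => κ p.2 • (v (p.1 + p.2) - v p.1) * f p.1)
      (volume.prod volume) := by
    refine ((hf.integrable.norm.mul_prod ((integrable_singWeight h0 h1).const_mul (B * C)))).mono'
      (hm.mul hf.integrable.aestronglyMeasurable.comp_fst) (Eventually.of_forall fun p => ?_)
    rw [norm_mul, mul_comm]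
    gcongr
    exact hv.norm_smul_le hB p.1 p.2
  have hi2 : Integrable (fun p : E n × E n => v p.1 * (κ p.2 • (f (p.1 + p.2) - f p.1)))
      (volume.prod volume) := by
    refine ((hf.integrable_prod h0 h1 hκ).norm.const_mul M).mono'
      ((hv.continuous.aestronglyMeasurable.comp_fst).mul
        (hf.integrable_prod h0 h1 hκ).aestronglyMeasurable) (Eventually.of_forall fun p => ?_)
    rw [norm_mul]
    gcongr
    exact hvM p.1
  calc ∫ x, diffOp κ v x * f x = ∫ x, ∫ z, κ z • (v (x + z) - v x) * f x := by
        simp only [diffOp, integral_mul_const]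
    _ = ∫ z, ∫ x, κ z • (v (x + z) - v x) * f x := integral_integral_swap hi1
    -- For fixed `z`, a translation by `z` moves the difference from `v` to `f` and replaces `z` by
    -- `-z` there. Evenness puts the same sign into the kernel, and the substitution `z ↦ -z` then
    -- removes both.
    _ = ∫ z, ∫ x, v x * (κ (-z) • (f (x + -z) - f x)) := by
        congr 1 with z
        have e1 : Integrable (fun x => v (x + z) * f x) :=
          hf.integrable.bdd_mul (c := M) (hv.continuous.comp
            (continuous_id.add continuous_const)).aestronglyMeasurable
            (Eventually.of_forall fun x => hvM _)
        have e2 : Integrable (fun x => v x * f x) :=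
          hf.integrable.bdd_mul (c := M) hv.continuous.aestronglyMeasurable
            (Eventually.of_forall fun x => hvM _)
        have e3 : Integrable (fun x => v x * f (x + -z)) :=
          (hf.integrable.comp_add_right (-z)).bdd_mul (c := M) hv.continuous.aestronglyMeasurable
            (Eventually.of_forall fun x => hvM _)
        have e4 : ∫ x, v (x + z) * f x = ∫ x, v x * f (x + -z) := by
          rw [← integral_add_right_eq_self (fun x => v x * f (x + -z)) z]
          simp
        calc ∫ x, κ z • (v (x + z) - v x) * f x
            = κ z * ∫ x, (v (x + z) * f x - v x * f x) := by
              rw [← integral_const_mul]; congr 1 with x; rw [smul_eq_mul]; ring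
          _ = κ z * ∫ x, (v x * f (x + -z) - v x * f x) := by
              rw [integral_sub e1 e2, integral_sub e3 e2, e4]
          _ = _ := by
              rw [← integral_const_mul]; congr 1 with x; rw [smul_eq_mul, heven]; ring
    _ = ∫ z, ∫ x, v x * (κ z • (f (x + z) - f x)) :=
        integral_neg_eq_self (fun z => ∫ x, v x * (κ z • (f (x + z) - f x))) volume
    _ = ∫ x, ∫ z, v x * (κ z • (f (x + z) - f x)) := (integral_integral_swap hi2).symm
    _ = _ := by simp only [diffOp, integral_const_mul]

section

variable {F : Type*} [NormedAddCommGroup F] {C : ℝ} {g : E n → F}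

/-- The difference `g (x + z) - g x` vanishes outside `S` and its translate by `-z`, a set of
measure at most twice that of `S`. -/
theorem SupLipschitz.l1Lipschitz [NeZero n] (h : SupLipschitz C g) {S : Set (E n)}
    (hS : MeasurableSet S) (hfin : volume S ≠ ⊤) (h0 : ∀ x ∉ S, g x = 0)
    (hg : Integrable g) : L1Lipschitz (C * (2 * volume.real S)) g := by
  refine ⟨hg, fun z => ?_⟩
  have hC := h.nonneg
  set T : Set (E n) := (fun x => x + z) ⁻¹' S
  have hT : volume T = volume S := measure_preimage_add_right volume z S
  have hTm : MeasurableSet T := hS.preimage (measurable_add_const z)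
  have hU : volume (S ∪ T) ≠ ⊤ := (measure_union_lt_top hfin.lt_top (hT ▸ hfin.lt_top)).ne
  calc ∫ x, ‖g (x + z) - g x‖
      ≤ ∫ x, (S ∪ T).indicator (fun _ => C * min 1 ‖z‖) x := by
        refine integral_mono ((hg.comp_add_right z).sub hg).norm
          ((integrable_indicator_iff (hS.union hTm)).2 (integrableOn_const hU)) fun x => ?_
        by_cases hx : x ∈ S ∪ T
        · rw [indicator_of_mem hx]; exact h.bound x z
        · rw [indicator_of_notMem hx]
          simp only [mem_union, not_or] at hx
          simp only [h0 x hx.1, h0 (x + z) hx.2, sub_self, norm_zero, le_refl]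
    _ = volume.real (S ∪ T) * (C * min 1 ‖z‖) := by
        rw [integral_indicator (hS.union hTm), setIntegral_const, smul_eq_mul]
    _ ≤ (2 * volume.real S) * (C * min 1 ‖z‖) := by
        gcongr
        refine (measureReal_union_le S T).trans (le_of_eq ?_)
        simp only [Measure.real, hT]; ring
    _ = _ := by ring

theorem SupLipschitz.of_lipschitzWith {K : NNReal} {M : ℝ} (hK : LipschitzWith K g)
    (hM : ∀ x, ‖g x‖ ≤ M) : SupLipschitz (max K (2 * M)) g := by
  refine ⟨hK.continuous, fun x z => ?_⟩
  have h1 : ‖g (x + z) - g x‖ ≤ K * ‖z‖ := by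
    have := hK.dist_le_mul (x + z) x
    rwa [dist_eq_norm, dist_eq_norm, add_sub_cancel_left] at this
  have h2 : ‖g (x + z) - g x‖ ≤ 2 * M := by
    refine (norm_sub_le _ _).trans ?_
    linarith [hM x, hM (x + z)]
  have hM0 : 0 ≤ M := (norm_nonneg _).trans (hM x)
  rcases le_total 1 ‖z‖ with h | h
  · rw [min_eq_left h, mul_one]; exact h2.trans (le_max_right _ _)
  · rw [min_eq_right h]; exact h1.trans (by gcongr; exact le_max_left _ _)

end

theorem exists_bound_of_hasCompactSupport {F : Type*} [NormedAddCommGroup F] {g : E n → F}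
    (hg : Continuous g) (hc : HasCompactSupport g) : ∃ M, ∀ x, ‖g x‖ ≤ M := by
  obtain ⟨M, hM⟩ := hc.exists_bound_of_continuous hg
  exact ⟨M, hM⟩

theorem IsTestFunction.exists_supLipschitz {φ : E n → ℝ} (h : IsTestFunction univ φ) :
    ∃ C, SupLipschitz C φ := by
  obtain ⟨K, hK⟩ := h.exists_lipschitzWith
  obtain ⟨M, hM⟩ := exists_bound_of_hasCompactSupport h.continuous h.hasCompactSupport
  exact ⟨_, SupLipschitz.of_lipschitzWith hK hM⟩

theorem IsTestFunction.integrable {U : Set (E n)} {φ : E n → ℝ} (h : IsTestFunction U φ) :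
    Integrable φ := h.continuous.integrable_of_hasCompactSupport h.hasCompactSupport

theorem measure_tsupport_ne_top {F : Type*} [NormedAddCommGroup F] {g : E n → F}
    (hc : HasCompactSupport g) : volume (tsupport g) ≠ ⊤ :=
  (IsCompact.measure_lt_top hc).ne

theorem IsTestFunction.exists_l1Lipschitz [NeZero n] {φ : E n → ℝ} (h : IsTestFunction univ φ) :
    ∃ C, L1Lipschitz C φ := by
  obtain ⟨C, hC⟩ := h.exists_supLipschitz
  exact ⟨_, hC.l1Lipschitz (isClosed_tsupport φ).measurableSet
    (measure_tsupport_ne_top h.hasCompactSupport)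
    (fun x hx => image_eq_zero_of_notMem_tsupport hx) h.integrable⟩

/-- First differences of a test function are small in `L¹`, uniformly to second order. -/
theorem IsTestFunction.exists_l1Lipschitz_diff [NeZero n] {φ : E n → ℝ}
    (h : IsTestFunction univ φ) :
    ∃ C, 0 ≤ C ∧ ∀ y, L1Lipschitz (C * ‖y‖) (fun x => φ (x + y) - φ x) := by
  obtain ⟨K, hK⟩ := h.exists_lipschitzWith
  have hfd : ContDiff ℝ 1 (fderiv ℝ φ) := h.smooth.fderiv_right (m := 1) (by norm_cast)
  obtain ⟨K', hK'⟩ : ∃ C, LipschitzWith C (fderiv ℝ φ) :=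
    ContDiff.lipschitzWith_of_hasCompactSupport (h.hasCompactSupport.fderiv ℝ) hfd one_ne_zero
  have hdiff : Differentiable ℝ φ := h.smooth.differentiable (by simp)
  set S := tsupport φ
  have hS : MeasurableSet S := (isClosed_tsupport φ).measurableSet
  -- The first difference has sup norm at most `K * ‖y‖` and Lipschitz constant at most `K' * ‖y‖`.
  -- It lives on `S ∪ T`, which gives the inner factor 2; the outer one comes from
  -- `SupLipschitz.l1Lipschitz`.
  refine ⟨max (K' : ℝ) (2 * K) * (2 * (2 * volume.real S)), by positivity, fun y => ?_⟩
  have hφy : ∀ x, ‖φ (x + y) - φ x‖ ≤ K * ‖y‖ := fun x => by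
    have := hK.dist_le_mul (x + y) x
    rwa [dist_eq_norm, dist_eq_norm, add_sub_cancel_left] at this
  have hlip : LipschitzWith (K' * ‖y‖₊) (fun x => φ (x + y) - φ x) := by
    refine lipschitzWith_of_nnnorm_fderiv_le (𝕜 := ℝ) (by fun_prop) fun x => ?_
    rw [fderiv_fun_sub (by fun_prop) (by fun_prop), fderiv_comp_add_right]
    have := hK'.dist_le_mul (x + y) x
    rw [dist_eq_norm, dist_eq_norm, add_sub_cancel_left] at this
    exact_mod_cast this
  have hsup := SupLipschitz.of_lipschitzWith hlip hφy
  set T : Set (E n) := (fun x => x + y) ⁻¹' S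
  have hT : volume T = volume S := measure_preimage_add_right volume y S
  have hTm : MeasurableSet T := hS.preimage (measurable_add_const y)
  have hfin := measure_tsupport_ne_top h.hasCompactSupport
  have hU : volume (S ∪ T) ≠ ⊤ := (measure_union_lt_top hfin.lt_top (hT ▸ hfin.lt_top)).ne
  have hL1 := hsup.l1Lipschitz (hS.union hTm) hU (fun x hx => by
    simp only [mem_union, not_or] at hx
    rw [image_eq_zero_of_notMem_tsupport hx.1,
      image_eq_zero_of_notMem_tsupport (show x + y ∉ tsupport φ from hx.2), sub_zero])
    ((h.integrable.comp_add_right y).sub h.integrable)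
  refine ⟨hL1.integrable, fun z => (hL1.bound z).trans ?_⟩
  have h1 : volume.real (S ∪ T) ≤ 2 * volume.real S := by
    refine (measureReal_union_le S T).trans (le_of_eq ?_)
    simp only [Measure.real, hT]; ring
  have h2 : max ((K' * ‖y‖₊ : NNReal) : ℝ) (2 * (K * ‖y‖)) = max (K' : ℝ) (2 * K) * ‖y‖ := by
    rw [max_mul_of_nonneg _ _ (norm_nonneg y)]; push_cast; ring_nf
  rw [h2]
  calc max (K' : ℝ) (2 * K) * ‖y‖ * (2 * volume.real (S ∪ T)) * min 1 ‖z‖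
      ≤ max (K' : ℝ) (2 * K) * ‖y‖ * (2 * (2 * volume.real S)) * min 1 ‖z‖ := by gcongr
    _ = _ := by ring

theorem diffOp_comp_add {κ : E n → ℝ} {φ : E n → ℝ} (y x : E n) :
    diffOp κ φ (x + y) = diffOp κ (fun x => φ (x + y)) x := by
  simp only [diffOp, add_right_comm]

theorem IsTestFunction.diffOp_add_sub [NeZero n] {β : ℝ} (h0 : 0 < β) (h1 : β < 1) {κ : E n → ℝ}
    (hκ : IsKernel β κ) {φ : E n → ℝ} (h : IsTestFunction univ φ) (x y : E n) :
    diffOp κ φ (x + y) - diffOp κ φ x = diffOp κ (fun x => φ (x + y) - φ x) x := by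
  obtain ⟨C, hC⟩ := h.exists_supLipschitz
  have e1 := hC.integrable h0 h1 hκ (x + y)
  have e2 := hC.integrable h0 h1 hκ x
  rw [diffOp, diffOp, ← integral_sub e1 e2, diffOp]
  congr 1 with z
  rw [add_right_comm]
  simp only [smul_eq_mul]; ring

/-- Since `diffOp κ` commutes with translations, an increment of `diffOp κ φ` is `diffOp κ` of an
increment of `φ`, whose `L¹` constant is of order `‖y‖`. Thus a second difference operator can be
applied to the result. -/
theorem IsTestFunction.exists_l1Lipschitz_diffOp [NeZero n] {β : ℝ} (h0 : 0 < β) (h1 : β < 1)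
    {κ : E n → ℝ} (hκ : IsKernel β κ) {φ : E n → ℝ} (h : IsTestFunction univ φ) :
    ∃ C, L1Lipschitz C (diffOp κ φ) := by
  obtain ⟨B, hB0, hB⟩ := hκ.exists_bound
  obtain ⟨D, hD⟩ := h.exists_l1Lipschitz
  obtain ⟨C, hC0, hC⟩ := h.exists_l1Lipschitz_diff
  set I := ∫ z, singWeight n β z
  have hI : 0 ≤ I := integral_nonneg fun z => singWeight_nonneg β z
  have hi := hD.integrable_diffOp h0 h1 hκ
  set A := ∫ x, ‖diffOp κ φ x‖
  have hA : 0 ≤ A := integral_nonneg fun z => norm_nonneg _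
  refine ⟨max (2 * A) (B * C * I), hi, fun y => ?_⟩
  have b1 : ∫ x, ‖diffOp κ φ (x + y) - diffOp κ φ x‖ ≤ 2 * A := by
    calc _ ≤ ∫ x, (‖diffOp κ φ (x + y)‖ + ‖diffOp κ φ x‖) :=
          integral_mono ((hi.comp_add_right y).sub hi).norm
            ((hi.comp_add_right y).norm.add hi.norm) fun x => norm_sub_le _ _
      _ = 2 * A := by
          rw [integral_add (hi.comp_add_right y).norm hi.norm,
            integral_add_right_eq_self (fun x => ‖diffOp κ φ x‖) y]; ring
  have b2 : ∫ x, ‖diffOp κ φ (x + y) - diffOp κ φ x‖ ≤ B * C * I * ‖y‖ := by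
    simp only [h.diffOp_add_sub h0 h1 hκ]
    exact ((hC y).integral_norm_diffOp_le h0 h1 hκ hB).trans (le_of_eq (by ring))
  rcases le_total 1 ‖y‖ with hy | hy
  · rw [min_eq_left hy, mul_one]; exact b1.trans (le_max_left _ _)
  · rw [min_eq_right hy]; exact b2.trans (by gcongr; exact le_max_right _ _)

/-! ### The kernels of the Riesz gradient and of the fractional Laplacian -/

/-- The kernel of the component in direction `e` of the Riesz fractional gradient. -/
noncomputable def gradKernel (α : ℝ) (e z : E n) : ℝ := inner ℝ e z * ‖z‖ ^ (-(n + α + 1))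

/-- The kernel of the fractional Laplacian. -/
noncomputable def lapKernel (s : ℝ) (z : E n) : ℝ := ‖z‖ ^ (-(n + s))

theorem isKernel_lapKernel (s : ℝ) : IsKernel (n := n) s (lapKernel s) where
  measurable := by unfold lapKernel; fun_prop
  exists_bound := ⟨1, zero_le_one, fun z => by
    rw [one_mul, lapKernel, abs_of_nonneg (by positivity)]⟩

theorem lapKernel_neg (s : ℝ) (z : E n) : lapKernel s (-z) = lapKernel s z := by
  simp [lapKernel]

/-- Equality can fail only at `z = 0`, where `0 ^ 0 = 1` when `p = 0`. -/
theorem norm_mul_rpow (z : E n) (p : ℝ) : ‖z‖ * ‖z‖ ^ (-(p + 1)) ≤ ‖z‖ ^ (-p) := by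
  rcases eq_or_ne z 0 with rfl | hz
  · simp only [norm_zero, zero_mul]; positivity
  · have : 0 < ‖z‖ := norm_pos_iff.2 hz
    rw [neg_add, Real.rpow_add this, Real.rpow_neg_one, mul_left_comm, mul_inv_cancel₀ this.ne',
      mul_one]

theorem isKernel_gradKernel (α : ℝ) (e : E n) : IsKernel α (gradKernel α e) where
  measurable := by unfold gradKernel; fun_prop
  exists_bound := ⟨‖e‖, norm_nonneg e, fun z => by
    rw [gradKernel, abs_mul, abs_of_nonneg (by positivity : 0 ≤ ‖z‖ ^ (-(n + α + 1)))]
    calc |inner ℝ e z| * ‖z‖ ^ (-(n + α + 1)) ≤ (‖e‖ * ‖z‖) * ‖z‖ ^ (-(n + α + 1)) := by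
          gcongr; exact abs_real_inner_le_norm e z
      _ = ‖e‖ * (‖z‖ * ‖z‖ ^ (-(n + α + 1))) := by ring
      _ ≤ _ := by gcongr; exact norm_mul_rpow z _⟩

theorem rieszConst_pos (n : ℕ) {α : ℝ} (h0 : 0 < α) (h1 : α < 1) : 0 < rieszConst n α := by
  have e1 : 0 < Real.Gamma (((n : ℝ) + α + 1) / 2) := Real.Gamma_pos_of_pos (by positivity)
  have e2 : 0 < Real.Gamma ((1 - α) / 2) := Real.Gamma_pos_of_pos (by linarith)
  unfold rieszConst
  have := Real.pi_pos
  positivity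

theorem inner_rieszGradient [NeZero n] {α : ℝ} (h0 : 0 < α) (h1 : α < 1) {C : ℝ} {φ : E n → ℝ}
    (h : SupLipschitz C φ) (e x : E n) :
    inner ℝ e (rieszGradient α φ x) = rieszConst n α * diffOp (gradKernel α e) φ x := by
  have hc := h.continuous
  have e1 : ∫ y, ((φ y - φ x) / ‖y - x‖ ^ ((n : ℝ) + α)) • (‖y - x‖⁻¹ • (y - x))
      = ∫ z, ((φ (x + z) - φ x) / ‖z‖ ^ ((n : ℝ) + α)) • (‖z‖⁻¹ • z) := by
    rw [← integral_add_left_eq_self _ x]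
    simp only [add_sub_cancel_left]
  have hint : Integrable fun z => ((φ (x + z) - φ x) / ‖z‖ ^ ((n : ℝ) + α)) • (‖z‖⁻¹ • z) := by
    refine ((integrable_singWeight h0 h1).const_mul C).mono'
      (Measurable.aestronglyMeasurable (by fun_prop)) (Eventually.of_forall fun z => ?_)
    rw [norm_smul, norm_smul, norm_inv, norm_norm, norm_div,
      Real.norm_of_nonneg (by positivity : 0 ≤ ‖z‖ ^ ((n : ℝ) + α)), singWeight, ← mul_assoc C,
      Real.rpow_neg (norm_nonneg z), ← div_eq_mul_inv]
    refine (mul_le_of_le_one_right (by positivity) inv_mul_le_one).trans ?_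
    gcongr
    exact h.bound x z
  rw [rieszGradient, inner_smul_right, e1, ← integral_inner hint, diffOp]
  congr 2 with z
  rw [inner_smul_right, inner_smul_right, gradKernel, smul_eq_mul]
  rcases eq_or_ne z 0 with rfl | hz
  · simp
  · have : 0 < ‖z‖ := norm_pos_iff.2 hz
    rw [neg_add (_ + α), Real.rpow_add this (-(_ + α)), Real.rpow_neg this.le, Real.rpow_neg_one]
    ring

theorem inner_rieszGradient_test [NeZero n] {α : ℝ} (h0 : 0 < α) (h1 : α < 1) {φ : E n → ℝ}
    (h : IsTestFunction univ φ) (e x : E n) :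
    inner ℝ e (rieszGradient α φ x) = rieszConst n α * diffOp (gradKernel α e) φ x :=
  inner_rieszGradient h0 h1 h.exists_supLipschitz.choose_spec e x

theorem integrable_rieszGradient [NeZero n] {α : ℝ} (h0 : 0 < α) (h1 : α < 1) {φ : E n → ℝ}
    (h : IsTestFunction univ φ) : Integrable (rieszGradient α φ) := by
  refine Integrable.of_eval_piLp fun i => ?_
  obtain ⟨C, hC⟩ := h.exists_l1Lipschitz
  have := (hC.integrable_diffOp h0 h1
    (isKernel_gradKernel α (EuclideanSpace.single i 1))).const_mul (rieszConst n α)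
  refine this.congr (Eventually.of_forall fun x => ?_)
  simp only [← inner_rieszGradient_test h0 h1 h]
  simp [EuclideanSpace.inner_single_left]

/-! ### Fourier multipliers of difference operators -/

/-- The character `x ↦ exp(2πi⟨x,ξ⟩)`. -/
noncomputable def planeWave (ξ x : E n) : ℂ := Complex.exp (2 * Real.pi * inner ℝ x ξ * Complex.I)

theorem planeWave_zero_right (ξ : E n) : planeWave ξ 0 = 1 := by simp [planeWave]

theorem planeWave_zero_left (x : E n) : planeWave 0 x = 1 := by simp [planeWave]

theorem planeWave_add (ξ x y : E n) : planeWave ξ (x + y) = planeWave ξ x * planeWave ξ y := by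
  rw [planeWave, planeWave, planeWave, ← Complex.exp_add, inner_add_left]
  congr 1; push_cast; ring

theorem norm_planeWave (ξ x : E n) : ‖planeWave ξ x‖ = 1 := by
  rw [planeWave, ← Complex.norm_exp_ofReal_mul_I (2 * Real.pi * inner ℝ x ξ)]
  push_cast; rfl

theorem continuous_planeWave (ξ : E n) : Continuous (planeWave ξ) := by
  unfold planeWave; fun_prop

theorem supLipschitz_planeWave (ξ : E n) :
    SupLipschitz (max (2 * Real.pi * ‖ξ‖) 2) (planeWave ξ) := by
  refine ⟨continuous_planeWave ξ, fun x z => ?_⟩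
  have e : ‖planeWave ξ (x + z) - planeWave ξ x‖ = ‖planeWave ξ z - 1‖ := by
    rw [planeWave_add, ← mul_sub_one, norm_mul, norm_planeWave, one_mul]
  rw [e]
  have hpi := Real.pi_pos
  rcases le_total 1 ‖z‖ with h | h
  · rw [min_eq_left h, mul_one]
    refine ((norm_sub_le _ _).trans ?_).trans (le_max_right _ _)
    rw [norm_planeWave, norm_one]; norm_num
  · rw [min_eq_right h]
    refine le_trans ?_ (mul_le_mul_of_nonneg_right (le_max_left _ _) (norm_nonneg z))
    have := Real.norm_exp_I_mul_ofReal_sub_one_le (x := 2 * Real.pi * inner ℝ z ξ)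
    rw [planeWave]
    calc _ ≤ ‖2 * Real.pi * inner ℝ z ξ‖ := by
          convert this using 4; push_cast; ring
      _ = 2 * Real.pi * |inner ℝ z ξ| := by
          rw [norm_mul, Real.norm_of_nonneg (by positivity), Real.norm_eq_abs]
      _ ≤ 2 * Real.pi * (‖z‖ * ‖ξ‖) := by gcongr; exact abs_real_inner_le_norm z ξ
      _ = _ := by ring

/-- The Fourier symbol of `diffOp κ`. -/
noncomputable def symbol (κ : E n → ℝ) (ξ : E n) : ℂ := ∫ z, κ z • (planeWave ξ z - 1)

theorem integrable_symbol [NeZero n] {β : ℝ} (h0 : 0 < β) (h1 : β < 1) {κ : E n → ℝ}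
    (hκ : IsKernel β κ) (ξ : E n) : Integrable fun z => κ z • (planeWave ξ z - 1) := by
  simpa [planeWave_zero_right] using (supLipschitz_planeWave ξ).integrable h0 h1 hκ 0

theorem symbol_zero (κ : E n → ℝ) : symbol κ 0 = 0 := by simp [symbol, planeWave_zero_left]

theorem fourier_eq_planeWave (f : E n → ℂ) (ξ : E n) : 𝓕 f ξ = ∫ x, planeWave ξ (-x) * f x := by
  rw [Real.fourier_eq']
  congr 1 with x
  rw [smul_eq_mul, planeWave, inner_neg_left]
  congr 2; push_cast; ring

/-- Translating `f` by `z` multiplies its Fourier transform by `planeWave ξ z`; the rest is Fubini.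
-/
theorem fourier_diffOp [NeZero n] {β : ℝ} (h0 : 0 < β) (h1 : β < 1) {κ : E n → ℝ}
    (hκ : IsKernel β κ) {C : ℝ} {f : E n → ℂ} (hf : L1Lipschitz C f) (ξ : E n) :
    𝓕 (diffOp κ f) ξ = symbol κ ξ * 𝓕 f ξ := by
  have hint := hf.integrable_prod h0 h1 hκ
  have hw : ∀ g : E n → ℂ, Integrable g → Integrable fun x => planeWave ξ (-x) * g x := fun g hg =>
    hg.bdd_mul (c := 1) ((continuous_planeWave ξ).comp continuous_neg).aestronglyMeasurable
      (Eventually.of_forall fun x => (norm_planeWave _ _).le)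
  have hint2 : Integrable (fun p : E n × E n =>
      planeWave ξ (-p.1) * (κ p.2 • (f (p.1 + p.2) - f p.1))) (volume.prod volume) :=
    hint.bdd_mul (c := 1) ((continuous_planeWave ξ).comp (by fun_prop)).aestronglyMeasurable
      (Eventually.of_forall fun x => (norm_planeWave _ _).le)
  calc 𝓕 (diffOp κ f) ξ
      = ∫ x, ∫ z, planeWave ξ (-x) * (κ z • (f (x + z) - f x)) := by
        rw [fourier_eq_planeWave]; simp only [diffOp, integral_const_mul]
    _ = ∫ z, ∫ x, planeWave ξ (-x) * (κ z • (f (x + z) - f x)) := integral_integral_swap hint2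
    _ = ∫ z, (κ z • (planeWave ξ z - 1)) * 𝓕 f ξ := by
        congr 1 with z
        have e1 : ∫ x, planeWave ξ (-x) * f (x + z) = planeWave ξ z * 𝓕 f ξ := by
          rw [fourier_eq_planeWave, ← integral_const_mul,
            ← integral_add_right_eq_self (fun x => planeWave ξ z * (planeWave ξ (-x) * f x)) z]
          congr 1 with x
          rw [← mul_assoc, ← planeWave_add]
          congr 2; abel
        calc ∫ x, planeWave ξ (-x) * (κ z • (f (x + z) - f x))
            = (κ z : ℂ) * ∫ x, (planeWave ξ (-x) * f (x + z) - planeWave ξ (-x) * f x) := by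
              rw [← integral_const_mul]; congr 1 with x; rw [Complex.real_smul]; ring
          _ = _ := by
              rw [integral_sub (hw _ (hf.integrable.comp_add_right z)) (hw _ hf.integrable), e1,
                ← fourier_eq_planeWave, Complex.real_smul]
              ring
    _ = _ := integral_mul_const _ _

/-- Every test function is the Fourier transform of a Schwartz function, so pairing `f` with it can
be rewritten as pairing `𝓕 f` with a Schwartz function. -/
theorem ae_eq_zero_of_fourier_eq_zero {f : E n → ℂ} (hf : Integrable f) (h : ∀ ξ, 𝓕 f ξ = 0) :
    f =ᵐ[volume] 0 := by
  refine ae_eq_zero_of_integral_contDiff_smul_eq_zero hf.locallyIntegrable fun g hg hgc => ?_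
  have hg' : ContDiff ℝ ∞ (fun x => (g x : ℂ)) := Complex.ofRealCLM.contDiff.comp hg
  have hgc' : HasCompactSupport (fun x => (g x : ℂ)) := hgc.comp_left Complex.ofReal_zero
  set G : SchwartzMap (E n) ℂ := hgc'.toSchwartzMap hg'
  set H : SchwartzMap (E n) ℂ := 𝓕⁻ G
  have h1 : ∫ ξ, 𝓕 f ξ • H ξ = ∫ x, f x • 𝓕 (H : E n → ℂ) x :=
    VectorFourier.integral_fourierIntegral_smul_eq_flip (L := innerₗ (E n))
      Real.continuous_fourierChar continuous_inner hf H.integrable |>.trans (by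
        simp only [flip_innerₗ]; rfl)
  have h2 : 𝓕 (H : E n → ℂ) = G := by
    rw [← SchwartzMap.fourier_coe]
    simp [H]
  rw [h2] at h1
  simp only [h, zero_smul, integral_zero] at h1
  rw [h1]
  congr 1 with x
  rw [smul_eq_mul, Complex.real_smul, mul_comm]
  rfl

/-! ### Symmetries of symbols -/

theorem planeWave_smul (t : ℝ) (ξ z : E n) : planeWave (t • ξ) z = planeWave ξ (t • z) := by
  rw [planeWave, planeWave, inner_smul_left, inner_smul_right]; rfl

/-- Under the substitution `z ↦ t • z` the kernel contributes `t ^ (n + β)` and Lebesgue measure `t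
^ (-n)`. -/
theorem symbol_smul {β : ℝ} {κ : E n → ℝ}
    (hκ : ∀ t : ℝ, 0 < t → ∀ z, κ (t • z) = t ^ (-(n + β)) * κ z) {t : ℝ} (ht : 0 < t) (ξ : E n) :
    symbol κ (t • ξ) = ((t ^ β : ℝ) : ℂ) * symbol κ ξ := by
  have h := Measure.integral_comp_smul (volume : Measure (E n))
    (fun z => κ z • (planeWave ξ z - 1)) t
  rw [finrank_euclideanSpace_fin] at h
  have e : symbol κ (t • ξ) = ((t ^ (n + β) : ℝ) : ℂ) *
      ∫ z, κ (t • z) • (planeWave ξ (t • z) - 1) := by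
    rw [symbol, ← integral_const_mul]
    congr 1 with z
    rw [planeWave_smul, hκ t ht, mul_smul, Complex.real_smul, Complex.real_smul,
      ← mul_assoc, ← Complex.ofReal_mul, ← Real.rpow_add ht, add_neg_cancel, Real.rpow_zero,
      Complex.ofReal_one, one_mul]
  rw [e, h, Complex.real_smul, ← mul_assoc, ← Complex.ofReal_mul, ← symbol]
  congr 2
  rw [abs_of_pos (by positivity), Real.rpow_add ht, Real.rpow_natCast]
  field_simp

theorem symbol_isometry (κ : E n → ℝ) (R : E n ≃ₗᵢ[ℝ] E n) (ξ : E n) :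
    symbol κ (R ξ) = symbol (fun z => κ (R z)) ξ := by
  rw [symbol, ← R.measurePreserving.integral_comp R.toHomeomorph.measurableEmbedding, symbol]
  congr 1 with z
  rw [planeWave, planeWave, R.inner_map_map]

theorem symbol_neg (κ : E n → ℝ) (ξ : E n) :
    symbol κ (-ξ) = (starRingEnd ℂ) (symbol κ ξ) := by
  rw [symbol, symbol, ← integral_conj]
  congr 1 with z
  rw [Complex.real_smul, Complex.real_smul, map_mul, Complex.conj_ofReal, map_sub, map_one,
    planeWave, planeWave, ← Complex.exp_conj, inner_neg_right]
  simp [map_ofNat]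

theorem gradKernel_smul (α : ℝ) (e : E n) {t : ℝ} (ht : 0 < t) (z : E n) :
    gradKernel α e (t • z) = t ^ (-(n + α)) * gradKernel α e z := by
  rw [gradKernel, gradKernel, inner_smul_right, norm_smul, Real.norm_of_nonneg ht.le,
    Real.mul_rpow ht.le (norm_nonneg z), neg_add (_ + α), Real.rpow_add ht (-(_ + α)),
    Real.rpow_neg_one]
  field_simp

theorem lapKernel_smul (s : ℝ) {t : ℝ} (ht : 0 < t) (z : E n) :
    lapKernel s (t • z) = t ^ (-(n + s)) * lapKernel s z := by
  rw [lapKernel, lapKernel, norm_smul, Real.norm_of_nonneg ht.le,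
    Real.mul_rpow ht.le (norm_nonneg z)]

theorem gradKernel_isometry (α : ℝ) (e : E n) (R : E n ≃ₗᵢ[ℝ] E n) (z : E n) :
    gradKernel α (R e) (R z) = gradKernel α e z := by
  rw [gradKernel, gradKernel, R.inner_map_map, R.norm_map]

theorem symbol_gradKernel_isometry (α : ℝ) (e ξ : E n) (R : E n ≃ₗᵢ[ℝ] E n) :
    symbol (gradKernel α (R e)) (R ξ) = symbol (gradKernel α e) ξ := by
  rw [symbol_isometry]; simp only [gradKernel_isometry]

theorem symbol_lapKernel_isometry (s : ℝ) (ξ : E n) (R : E n ≃ₗᵢ[ℝ] E n) :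
    symbol (lapKernel s) (R ξ) = symbol (lapKernel s) ξ := by
  rw [symbol_isometry]; simp only [symbol, lapKernel, R.norm_map]

theorem symbol_gradKernel_add_smul [NeZero n] {α : ℝ} (h0 : 0 < α) (h1 : α < 1) (a : ℝ)
    (e e' ξ : E n) : symbol (gradKernel α (a • e + e')) ξ =
      a * symbol (gradKernel α e) ξ + symbol (gradKernel α e') ξ := by
  rw [symbol, symbol, symbol, ← integral_const_mul, ← integral_add
    ((integrable_symbol h0 h1 (isKernel_gradKernel α e) ξ).const_mul _)
    (integrable_symbol h0 h1 (isKernel_gradKernel α e') ξ)]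
  congr 1 with z
  simp only [gradKernel, inner_add_left, inner_smul_left, Complex.real_smul]
  push_cast
  simp only [conj_trivial]
  ring

/-- The reflection that sends `e` to `-e` fixes `ξ`, so the symbol equals its own negative. -/
theorem symbol_gradKernel_of_orthogonal (α : ℝ) {e ξ : E n} (h : inner ℝ e ξ = 0) :
    symbol (gradKernel α e) ξ = 0 := by
  set R := (ℝ ∙ e)ᗮ.reflection
  have h1 : R e = -e := Submodule.reflection_orthogonalComplement_singleton_eq_neg e
  have h2 : R ξ = ξ := by
    apply Submodule.reflection_mem_subspace_eq_self
    rw [Submodule.mem_orthogonal_singleton_iff_inner_right]; exact h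
  have h3 := symbol_gradKernel_isometry α e ξ R
  rw [h1, h2] at h3
  have h4 : symbol (gradKernel α (-e)) ξ = -symbol (gradKernel α e) ξ := by
    rw [symbol, symbol, ← integral_neg]
    congr 1 with z
    simp [gradKernel, inner_neg_left]
  rw [h4] at h3
  exact self_eq_neg.1 h3.symm

theorem exists_isometry_eq {e ξ : E n} (h : ‖e‖ = ‖ξ‖) : ∃ R : E n ≃ₗᵢ[ℝ] E n, R e = ξ :=
  ⟨_, Submodule.reflection_sub h⟩

theorem symbol_lapKernel_eq {s : ℝ} {e ξ : E n} (he : ‖e‖ = 1) (hξ : ξ ≠ 0) :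
    symbol (lapKernel s) ξ = ((‖ξ‖ ^ s : ℝ) : ℂ) * symbol (lapKernel s) e := by
  have hpos : 0 < ‖ξ‖ := norm_pos_iff.2 hξ
  obtain ⟨R, hR⟩ := exists_isometry_eq (e := ‖ξ‖ • e) (ξ := ξ) (by simp [norm_smul, he])
  rw [← hR, symbol_lapKernel_isometry, symbol_smul (fun t ht z => lapKernel_smul s ht z) hpos, hR]

/-- Split `e` into its parts parallel and orthogonal to `ξ`. The orthogonal part contributes
nothing; the parallel part is carried to `e₀` by an isometry and homogeneity. -/
theorem symbol_gradKernel_eq [NeZero n] {α : ℝ} (h0 : 0 < α) (h1 : α < 1) {e₀ e ξ : E n}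
    (he : ‖e₀‖ = 1) (hξ : ξ ≠ 0) : symbol (gradKernel α e) ξ =
      ((inner ℝ e ξ * ‖ξ‖ ^ (α - 1) : ℝ) : ℂ) * symbol (gradKernel α e₀) e₀ := by
  have hpos : 0 < ‖ξ‖ := norm_pos_iff.2 hξ
  obtain ⟨R, hR⟩ := exists_isometry_eq (e := ‖ξ‖ • e₀) (ξ := ξ) (by simp [norm_smul, he])
  have hdec : e = (inner ℝ e ξ / ‖ξ‖) • R e₀ + (e - (inner ℝ e ξ / ‖ξ‖) • R e₀) := by abel
  have hRξ : ξ = ‖ξ‖ • R e₀ := by rw [← map_smul, hR]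
  have horth : inner ℝ (e - (inner ℝ e ξ / ‖ξ‖) • R e₀) ξ = 0 := by
    have hin : inner ℝ (R e₀) ξ = ‖ξ‖ := by
      conv_lhs => rw [hRξ]
      rw [inner_smul_right, real_inner_self_eq_norm_sq, R.norm_map, he]; ring
    rw [inner_sub_left, inner_smul_left, hin]
    simp only [conj_trivial]
    field_simp; ring
  have hs : symbol (gradKernel α (R e₀)) ξ
      = ((‖ξ‖ ^ α : ℝ) : ℂ) * symbol (gradKernel α e₀) e₀ := by
    nth_rewrite 1 [hRξ]
    rw [symbol_smul (fun t ht z => gradKernel_smul α _ ht z) hpos, symbol_gradKernel_isometry]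
  rw [hdec, symbol_gradKernel_add_smul h0 h1, symbol_gradKernel_of_orthogonal α horth, add_zero,
    ← hdec, hs, ← mul_assoc, ← Complex.ofReal_mul, Real.rpow_sub_one hpos.ne']
  congr 2; ring

/-! ### Symbols do not vanish -/

theorem L1Lipschitz.ofReal {C : ℝ} {f : E n → ℝ} (h : L1Lipschitz C f) :
    L1Lipschitz C (fun x => (f x : ℂ)) where
  integrable := h.integrable.ofReal
  bound z := by
    have := h.bound z
    simpa only [← Complex.ofReal_sub, Complex.norm_real] using this

theorem diffOp_ofReal (κ f : E n → ℝ) (x : E n) :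
    diffOp κ (fun x => (f x : ℂ)) x = ((diffOp κ f x : ℝ) : ℂ) := by
  rw [diffOp, diffOp, ← integral_complex_ofReal]
  congr 1 with z
  simp

/-- If the symbol vanished, `diffOp κ` would annihilate a bump function supported in the ball of
radius 2. But at `-3e` the bump is zero, and only those `z` contribute for which `-3e + z` lies in
that ball; they satisfy `⟨e, z⟩ > 1`, so `κ z > 0` and the value is positive. This spares computing
the symbols. -/
theorem exists_symbol_ne_zero [NeZero n] {β : ℝ} (h0 : 0 < β) (h1 : β < 1) {κ : E n → ℝ}
    (hκ : IsKernel β κ) {e : E n} (he : ‖e‖ = 1) (hpos : ∀ z, 0 < inner ℝ e z → 0 < κ z) :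
    ∃ ξ, symbol κ ξ ≠ 0 := by
  by_contra! hzero
  let φ : ContDiffBump (0 : E n) := ⟨1, 2, one_pos, one_lt_two⟩
  have hφ : IsTestFunction univ φ := ⟨φ.contDiff, φ.hasCompactSupport, subset_univ _⟩
  obtain ⟨C, hC⟩ := hφ.exists_l1Lipschitz
  obtain ⟨D, hD⟩ := hφ.exists_supLipschitz
  have hF := ae_eq_zero_of_fourier_eq_zero (hC.ofReal.integrable_diffOp h0 h1 hκ) fun ξ => by
    rw [fourier_diffOp h0 h1 hκ hC.ofReal, hzero, zero_mul]
  have hF' : diffOp κ φ =ᵐ[volume] 0 := by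
    filter_upwards [hF] with x hx
    rw [diffOp_ofReal] at hx
    simpa using hx
  have hF0 : diffOp κ φ = 0 :=
    Measure.eq_of_ae_eq hF' (hD.continuous_diffOp h0 h1 hκ) continuous_const
  set x : E n := -((3 : ℝ) • e)
  have hx : ‖x‖ = 3 := by simp [x, norm_smul, he]
  have hφx : φ x = 0 := φ.zero_of_le_dist (by rw [dist_zero_right, hx]; norm_num)
  have hsupp : ∀ z, ‖x + z‖ < 2 → 0 < κ z := fun z hz => hpos z (by
    have e1 : inner ℝ e z = inner ℝ e (x + z) + 3 := by
      simp only [x, inner_add_right, inner_neg_right, inner_smul_right,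
        real_inner_self_eq_norm_sq, he]; ring
    have e2 := abs_real_inner_le_norm e (x + z)
    rw [he, one_mul] at e2
    have := neg_abs_le (inner ℝ e (x + z))
    linarith)
  have hint := hD.integrable h0 h1 hκ x
  have hlt : 0 < diffOp κ φ x := by
    rw [diffOp, integral_pos_iff_support_of_nonneg _ hint]
    · refine (measure_ball_pos volume (-x) one_pos).trans_le (measure_mono fun z hz => ?_)
      rw [mem_ball, dist_eq_norm, sub_neg_eq_add, add_comm] at hz
      have h2 : ‖x + z‖ < 2 := by linarith
      rw [Function.mem_support, hφx, sub_zero, smul_eq_mul]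
      have := φ.pos_of_mem_ball (x := x + z) (by rw [mem_ball_zero_iff]; exact h2)
      exact (mul_pos (hsupp z h2) this).ne'
    · intro z
      simp only [Pi.zero_apply, hφx, sub_zero, smul_eq_mul]
      rcases lt_or_ge ‖x + z‖ 2 with h2 | h2
      · exact mul_nonneg (hsupp z h2).le φ.nonneg
      · rw [φ.zero_of_le_dist (by rw [dist_zero_right]; exact h2), mul_zero]
  rw [hF0] at hlt
  exact lt_irrefl _ hlt

theorem exists_norm_eq_one (n : ℕ) [NeZero n] : ∃ e : E n, ‖e‖ = 1 :=
  exists_norm_eq (E n) zero_le_one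

theorem norm_pos_of_inner_pos {e z : E n} (h : 0 < inner ℝ e z) : 0 < ‖z‖ :=
  norm_pos_iff.2 fun hz => by simp [hz] at h

/-- The symbols of the Riesz gradient of order `α` and the fractional Laplacian of order `1 - α`
multiply to that of the gradient. -/
theorem exists_symbol_mul_symbol [NeZero n] {α : ℝ} (h0 : 0 < α) (h1 : α < 1) :
    ∃ c : ℝ, c ≠ 0 ∧ ∀ e ξ : E n, symbol (lapKernel (1 - α)) ξ * symbol (gradKernel α e) ξ =
      c * (2 * Real.pi * Complex.I * inner ℝ e ξ) := by
  obtain ⟨e₀, he₀⟩ := exists_norm_eq_one n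
  set a := symbol (gradKernel α e₀) e₀
  set b := symbol (lapKernel (1 - α)) e₀
  have he₀0 : e₀ ≠ 0 := fun h => by simp [h] at he₀
  have hprod : ∀ e ξ : E n, symbol (lapKernel (1 - α)) ξ * symbol (gradKernel α e) ξ =
      b * a * inner ℝ e ξ := by
    intro e ξ
    rcases eq_or_ne ξ 0 with rfl | hξ
    · simp [symbol_zero]
    · have hpos : 0 < ‖ξ‖ := norm_pos_iff.2 hξ
      have hr : ‖ξ‖ ^ (1 - α) * ‖ξ‖ ^ (α - 1) = 1 := by
        rw [← Real.rpow_add hpos]; simp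
      rw [symbol_lapKernel_eq he₀ hξ, symbol_gradKernel_eq h0 h1 he₀ hξ]
      calc _ = b * a * ((‖ξ‖ ^ (1 - α) * ‖ξ‖ ^ (α - 1) : ℝ) : ℂ) * inner ℝ e ξ := by
            push_cast; ring
        _ = _ := by rw [hr]; simp
  have ha : a ≠ 0 := by
    intro ha
    obtain ⟨ξ, hξ⟩ := exists_symbol_ne_zero h0 h1 (isKernel_gradKernel α e₀) he₀ fun z hz => by
      have := norm_pos_of_inner_pos hz
      unfold gradKernel; positivity
    rcases eq_or_ne ξ 0 with rfl | hξ0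
    · exact hξ (symbol_zero _)
    · apply hξ; rw [symbol_gradKernel_eq h0 h1 he₀ hξ0]; simp [a] at ha; rw [ha, mul_zero]
  have hb : b ≠ 0 := by
    intro hb
    obtain ⟨ξ, hξ⟩ := exists_symbol_ne_zero (by linarith) (by linarith)
      (isKernel_lapKernel (n := n) (1 - α)) he₀ fun z hz => by
        have := norm_pos_of_inner_pos hz
        unfold lapKernel; positivity
    rcases eq_or_ne ξ 0 with rfl | hξ0
    · exact hξ (symbol_zero _)
    · apply hξ; rw [symbol_lapKernel_eq he₀ hξ0]; simp [b] at hb; rw [hb, mul_zero]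
  -- Symbols of real kernels are conjugated by `ξ ↦ -ξ`, while the product is odd in `ξ`. So `b * a`
  -- is purely imaginary, and the constant `c` is real.
  have hconj : (starRingEnd ℂ) (b * a) = -(b * a) := by
    have e1 := hprod e₀ (-e₀)
    rw [symbol_neg, symbol_neg, ← map_mul] at e1
    simpa [inner_neg_right, he₀] using e1
  have hre : (b * a).re = 0 := by
    have := congrArg Complex.re hconj
    rw [Complex.conj_re, Complex.neg_re] at this
    linarith
  have hba : b * a = ((b * a).im : ℂ) * Complex.I := by
    apply Complex.ext <;> simp [hre]
  have hpi := Real.pi_pos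
  refine ⟨(b * a).im / (2 * Real.pi), ?_, fun e ξ => ?_⟩
  · intro h
    have him : (b * a).im = 0 := by
      rcases div_eq_zero_iff.1 h with h | h
      · exact h
      · exact absurd h (by positivity)
    rw [him] at hba
    simp [ha, hb] at hba
  · rw [hprod, hba]
    simp only [Complex.mul_im, Complex.ofReal_im, Complex.ofReal_re, Complex.I_im, Complex.I_re]
    push_cast
    have : (Real.pi : ℂ) ≠ 0 := by exact_mod_cast hpi.ne'
    field_simp
    simp
    ring

/-! ### Inverting the Riesz fractional gradient -/

theorem ae_eq_of_fourier_eq {f g : E n → ℂ} (hf : Integrable f) (hg : Integrable g)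
    (h : ∀ ξ, 𝓕 f ξ = 𝓕 g ξ) : f =ᵐ[volume] g := by
  have hw : ∀ ξ, ∀ g : E n → ℂ, Integrable g → Integrable fun x => planeWave ξ (-x) * g x :=
    fun ξ g hg => hg.bdd_mul (c := 1)
      ((continuous_planeWave ξ).comp continuous_neg).aestronglyMeasurable
      (Eventually.of_forall fun x => (norm_planeWave _ _).le)
  have := ae_eq_zero_of_fourier_eq_zero (hf.sub hg) fun ξ => by
    have h1 := h ξ
    rw [fourier_eq_planeWave, fourier_eq_planeWave] at h1
    rw [fourier_eq_planeWave]
    simp only [Pi.sub_apply, mul_sub]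
    rw [integral_sub (hw ξ f hf) (hw ξ g hg), h1, sub_self]
  filter_upwards [this] with x hx
  exact sub_eq_zero.1 hx

theorem IsTestFunction.fourier_fderiv {φ : E n → ℝ} (h : IsTestFunction univ φ) (e ξ : E n) :
    𝓕 (fun x => ((fderiv ℝ φ x e : ℝ) : ℂ)) ξ =
      2 * Real.pi * Complex.I * inner ℝ e ξ * 𝓕 (fun x => (φ x : ℂ)) ξ := by
  set ψ : E n → ℂ := fun x => (φ x : ℂ)
  have hψ : ContDiff ℝ ∞ ψ := Complex.ofRealCLM.contDiff.comp h.smooth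
  have hψc : HasCompactSupport ψ := h.hasCompactSupport.comp_left Complex.ofReal_zero
  have hd : ∀ x, ((fderiv ℝ φ x e : ℝ) : ℂ) = fderiv ℝ ψ x e := fun x => by
    have h1 : HasFDerivAt ψ (Complex.ofRealCLM.comp (fderiv ℝ φ x)) x :=
      Complex.ofRealCLM.hasFDerivAt.comp x
        (h.smooth.differentiable (by simp)).differentiableAt.hasFDerivAt
    rw [h1.fderiv]; rfl
  have hi : Integrable (fderiv ℝ ψ) :=
    (hψ.continuous_fderiv (by simp)).integrable_of_hasCompactSupport (hψc.fderiv ℝ)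
  simp only [hd]
  rw [← Real.fourier_continuousLinearMap_apply hi,
    Real.fourier_fderiv h.integrable.ofReal (hψ.differentiable (by simp)) hi]
  have hin : innerSL ℝ ξ e = inner ℝ e ξ := by
    rw [real_inner_comm]; exact innerSL_apply_apply ..
  simp only [VectorFourier.fourierSMulRight_apply, neg_apply, neg_smul,
    hin, Complex.real_smul, smul_eq_mul, neg_mul, mul_neg, neg_neg]
  ring

/-- Both sides are integrable with equal Fourier transforms, because the symbols of orders `1 - α`
and `α` multiply to that of the derivative. The constant depends on neither `φ` nor `e`. -/
theorem exists_diffOp_diffOp_eq [NeZero n] {α : ℝ} (h0 : 0 < α) (h1 : α < 1) :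
    ∃ c : ℝ, c ≠ 0 ∧ ∀ φ : E n → ℝ, IsTestFunction univ φ → ∀ e : E n,
      diffOp (lapKernel (1 - α)) (diffOp (gradKernel α e) φ) =ᵐ[volume]
        fun x => c * fderiv ℝ φ x e := by
  obtain ⟨c, hc, hsymb⟩ := exists_symbol_mul_symbol (n := n) h0 h1
  refine ⟨c, hc, fun φ hφ e => ?_⟩
  have hk1 := isKernel_gradKernel α e
  have hk2 := isKernel_lapKernel (n := n) (1 - α)
  obtain ⟨C, hC⟩ := hφ.exists_l1Lipschitz
  obtain ⟨D, hD⟩ := hφ.exists_l1Lipschitz_diffOp h0 h1 hk1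
  have h0' : 0 < 1 - α := by linarith
  have h1' : 1 - α < 1 := by linarith
  have hi : Integrable fun x => fderiv ℝ φ x e :=
    ((hφ.smooth.continuous_fderiv (by simp)).clm_apply continuous_const).integrable_of_hasCompactSupport
      (hφ.hasCompactSupport.fderiv_apply ℝ e)
  have := ae_eq_of_fourier_eq (hD.ofReal.integrable_diffOp h0' h1' hk2)
    (hi.ofReal.const_mul (c : ℂ)) fun ξ => by
      rw [fourier_diffOp h0' h1' hk2 hD.ofReal]
      have e1 : 𝓕 (fun x => ((diffOp (gradKernel α e) φ x : ℝ) : ℂ)) ξ =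
          symbol (gradKernel α e) ξ * 𝓕 (fun x => (φ x : ℂ)) ξ := by
        rw [← fourier_diffOp h0 h1 hk1 hC.ofReal]
        simp only [← diffOp_ofReal]
      have e2 : 𝓕 (fun x => (c : ℂ) * ((fderiv ℝ φ x e : ℝ) : ℂ)) ξ =
          c * 𝓕 (fun x => ((fderiv ℝ φ x e : ℝ) : ℂ)) ξ := by
        rw [fourier_eq_planeWave, fourier_eq_planeWave, ← integral_const_mul]
        congr 1 with x; ring
      rw [e1, ← mul_assoc, hsymb]
      refine Eq.trans ?_ e2.symm
      rw [hφ.fourier_fderiv]; ring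
  filter_upwards [this] with x hx
  rw [diffOp_ofReal] at hx
  simpa using congrArg Complex.re hx

theorem integral_smul_eq_neg_iff_inner {φ u : E n → ℝ} {v w : E n → E n}
    (hv : Integrable fun x => φ x • v x) (hw : Integrable fun x => u x • w x) :
    (∫ x, φ x • v x = -∫ x, u x • w x) ↔
      ∀ e : E n, ∫ x, φ x * inner ℝ e (v x) = -∫ x, u x * inner ℝ e (w x) := by
  have key1 : ∀ e, ∫ x, φ x * inner ℝ e (v x) = inner ℝ e (∫ x, φ x • v x) := fun e => by
    rw [← integral_inner hv]; simp only [inner_smul_right]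
  have key2 : ∀ e, ∫ x, u x * inner ℝ e (w x) = inner ℝ e (∫ x, u x • w x) := fun e => by
    rw [← integral_inner hw]; simp only [inner_smul_right]
  constructor
  · intro H e
    rw [key1, key2, H, inner_neg_right]
  · intro H
    refine ext_inner_left ℝ fun e => ?_
    rw [inner_neg_right, ← key1, ← key2, H]

theorem integrable_smul_rieszGradient [NeZero n] {α : ℝ} (h0 : 0 < α) (h1 : α < 1)
    {φ : E n → ℝ} (h : IsTestFunction univ φ) {u : E n → ℝ} (hu : MemLp u ⊤ volume) :
    Integrable fun x => u x • rieszGradient α φ x :=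
  (integrable_rieszGradient h0 h1 h).smul_of_top_right hu

/-- Every bounded Lipschitz function `v` has a fractional potential `u`: the classical gradient
of `v` is the `α`-fractional gradient of `u`. -/
theorem exists_fracPotential [NeZero n] {α : ℝ} (h0 : 0 < α) (h1 : α < 1) :
    ∃ c : ℝ, ∀ (v : E n → ℝ) (K : NNReal) (M : ℝ), LipschitzWith K v → (∀ x, |v x| ≤ M) →
      MemLp (fun x => c * diffOp (lapKernel (1 - α)) v x) ⊤ volume ∧
      HasWeakFracGradient α (fun x => c * diffOp (lapKernel (1 - α)) v x) (gradient v) := by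
  obtain ⟨c, hc, hcomp⟩ := exists_diffOp_diffOp_eq (n := n) h0 h1
  have hμ := rieszConst_pos n h0 h1
  have h0' : 0 < 1 - α := by linarith
  have h1' : 1 - α < 1 := by linarith
  have hk2 := isKernel_lapKernel (n := n) (1 - α)
  -- This factor cancels the normalisation of `∇^α` and the constant of the composition.
  refine ⟨(rieszConst n α * c)⁻¹, fun v K M hK hM => ?_⟩
  have hv := SupLipschitz.of_lipschitzWith hK hM
  obtain ⟨B, hB⟩ := hv.exists_norm_diffOp_le h0' h1' hk2
  have hcont := hv.continuous_diffOp h0' h1' hk2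
  have hmem : MemLp (fun x => (rieszConst n α * c)⁻¹ * diffOp (lapKernel (1 - α)) v x) ⊤ volume :=
    MemLp.const_mul (memLp_top_of_bound hcont.aestronglyMeasurable B (Eventually.of_forall hB)) _
  have hloc : LocallyIntegrable (gradient v) volume :=
    (memLp_top_gradient hK volume).locallyIntegrable le_top
  refine ⟨hmem, ⟨⟨0, _, MemLp.zero, hmem, (zero_add _).symm⟩, hloc, fun φ hφ => ?_⟩⟩
  rw [integral_smul_eq_neg_iff_inner (hφ.integrable_smul (hloc.locallyIntegrableOn _))
    (integrable_smul_rieszGradient h0 h1 hφ hmem)]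
  intro e
  have hw := (integral_smul_eq_iff_inner hφ
    ((hasWeakGradient_of_lipschitzWith hK univ).locallyIntegrableOn)
    ((hasWeakGradient_of_lipschitzWith hK univ).locallyIntegrableOn_gradient)).1
    ((hasWeakGradient_of_lipschitzWith hK univ).integral_eq φ hφ) e
  rw [setIntegral_univ, setIntegral_univ] at hw
  obtain ⟨D, hD⟩ := hφ.exists_l1Lipschitz_diffOp h0 h1 (isKernel_gradKernel α e)
  rw [hw]
  congr 1
  calc ∫ x, v x * fderiv ℝ φ x e
      = ∫ x, c⁻¹ * (v x * diffOp (lapKernel (1 - α)) (diffOp (gradKernel α e) φ) x) := by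
        refine integral_congr_ae ?_
        filter_upwards [hcomp φ hφ e] with x hx
        rw [hx]; field_simp
    -- The kernel of the fractional Laplacian is even, so the operator can be moved onto `v`.
    _ = c⁻¹ * ∫ x, diffOp (lapKernel (1 - α)) v x * diffOp (gradKernel α e) φ x := by
        rw [integral_const_mul,
          integral_diffOp_mul h0' h1' hk2 (lapKernel_neg (1 - α)) hv hM hD]
    _ = _ := by
        rw [← integral_const_mul]
        congr 1 with x
        rw [inner_rieszGradient_test h0 h1 hφ]
        field_simp

theorem diffOp_periodic {κ v : E n → ℝ} {a : E n} (h : ∀ x, v (x + a) = v x) (x : E n) :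
    diffOp κ v (x + a) = diffOp κ v x := by
  rw [diffOp_comp_add]
  simp only [h]

/-! ### The Riesz potential representation of the Riesz fractional gradient -/

theorem locallyIntegrable_norm_rpow [NeZero n] {p : ℝ} (hp : -(n : ℝ) < p) :
    LocallyIntegrable (fun z : E n => ‖z‖ ^ p) volume := fun x =>
  ⟨ball 0 (‖x‖ + 1), isOpen_ball.mem_nhds (by simp), integrableOn_ball_norm_rpow hp _⟩

theorem integral_fderiv_eq_zero {φ : E n → ℝ} (h : IsTestFunction univ φ) (e : E n) :
    ∫ x, fderiv ℝ φ x e = 0 := by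
  have hi : Integrable fun x => fderiv ℝ φ x e :=
    ((h.smooth.continuous_fderiv (by simp)).clm_apply continuous_const).integrable_of_hasCompactSupport
      (h.hasCompactSupport.fderiv_apply ℝ e)
  have := integral_mul_fderiv_eq_neg_fderiv_mul_of_integrable (μ := (volume : Measure (E n)))
    (f := fun _ => (1 : ℝ)) (g := φ) (v := e) (by simp) (by simpa using hi)
    (by simpa using h.integrable) (fun _ _ => by fun_prop)
    (fun _ _ => (h.smooth.differentiable (by simp)).differentiableAt)
  simpa using this

/-- Adding `ε` removes the singularity at the origin, so that one may integrate by parts on the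
whole space before letting `ε` tend to `0`. -/
theorem hasFDerivAt_regularized_rpow {ε : ℝ} (hε : 0 < ε) (r : ℝ) (z : E n) :
    HasFDerivAt (fun z : E n => (‖z‖ ^ 2 + ε) ^ r)
      ((2 * r * (‖z‖ ^ 2 + ε) ^ (r - 1)) • innerSL ℝ z) z := by
  have h1 : HasFDerivAt (fun z : E n => ‖z‖ ^ 2 + ε) (2 • innerSL ℝ z) z :=
    (hasStrictFDerivAt_norm_sq z).hasFDerivAt.add_const ε
  have h2 := h1.rpow_const (p := r) (Or.inl (by positivity))
  refine h2.congr_fderiv ?_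
  ext v
  simp only [smul_apply, nsmul_eq_mul, smul_eq_mul]
  push_cast; ring

theorem regularized_rpow_le {ε : ℝ} (hε : 0 ≤ ε) {r : ℝ} (hr : r ≤ 0) {z : E n} (hz : z ≠ 0) :
    (‖z‖ ^ 2 + ε) ^ r ≤ ‖z‖ ^ (2 * r) := by
  have : 0 < ‖z‖ := norm_pos_iff.2 hz
  rw [Real.rpow_mul (norm_nonneg z), ← Real.rpow_natCast ‖z‖ 2]
  push_cast
  exact Real.rpow_le_rpow_of_nonpos (by positivity) (by linarith) hr

theorem integrable_inner_mul_regularized [NeZero n] {α : ℝ} (h0 : 0 < α) (h1 : α < 1) {ε : ℝ}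
    (hε : 0 < ε) (e : E n) :
    Integrable fun z : E n => inner ℝ e z * (‖z‖ ^ 2 + ε) ^ (-(n + α + 1) / 2) := by
  set r : ℝ := -(n + α + 1) / 2
  have hr : r ≤ 0 := by
    have : (0 : ℝ) ≤ n := Nat.cast_nonneg n
    simp only [r]; linarith
  refine ((integrable_singWeight (n := n) h0 h1).const_mul (‖e‖ * max 1 (ε ^ r))).mono'
    ?_ (Eventually.of_forall fun z => ?_)
  · exact Measurable.aestronglyMeasurable (by fun_prop)
  · rcases eq_or_ne z 0 with rfl | hz
    · have := singWeight_nonneg (n := n) α 0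
      simp only [inner_zero_right, zero_mul, norm_zero]; positivity
    have hpos : 0 < ‖z‖ := norm_pos_iff.2 hz
    rw [norm_mul, Real.norm_of_nonneg (by positivity : 0 ≤ (‖z‖ ^ 2 + ε) ^ r), singWeight]
    rw [mul_assoc ‖e‖]
    refine (mul_le_mul_of_nonneg_right (norm_inner_le_norm e z) (by positivity)).trans ?_
    rw [mul_assoc ‖e‖]
    refine mul_le_mul_of_nonneg_left ?_ (norm_nonneg e)
    rcases le_total 1 ‖z‖ with h | h
    · rw [min_eq_left h, one_mul]
      calc ‖z‖ * (‖z‖ ^ 2 + ε) ^ r ≤ ‖z‖ * ‖z‖ ^ (-(n + α + 1)) := by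
            gcongr
            refine (regularized_rpow_le hε.le hr hz).trans (le_of_eq ?_)
            congr 1; simp only [r]; ring
        _ ≤ ‖z‖ ^ (-(n + α)) := norm_mul_rpow z _
        _ ≤ _ := le_mul_of_one_le_left (by positivity) (le_max_left _ _)
    · rw [min_eq_right h]
      have e1 : 1 ≤ ‖z‖ ^ (-(n + α)) := by
        refine Real.one_le_rpow_of_pos_of_le_one_of_nonpos hpos h ?_
        have : (0 : ℝ) ≤ n := Nat.cast_nonneg n
        linarith
      have e2 : (‖z‖ ^ 2 + ε) ^ r ≤ ε ^ r :=
        Real.rpow_le_rpow_of_nonpos hε (by nlinarith) hr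
      calc ‖z‖ * (‖z‖ ^ 2 + ε) ^ r ≤ ‖z‖ * max 1 (ε ^ r) := by
            gcongr; exact e2.trans (le_max_right _ _)
        _ = max 1 (ε ^ r) * (‖z‖ * 1) := by ring
        _ ≤ _ := by gcongr

/-- Integration by parts yields `φ (x + z)` alone. The term `φ x` may be subtracted because the
regularised kernel is odd and integrable, hence has integral zero; the subtraction is what survives
the limit `ε → 0`. -/
theorem IsTestFunction.regularized_integral_eq [NeZero n] {α : ℝ} (h0 : 0 < α) (h1 : α < 1)
    {φ : E n → ℝ} (h : IsTestFunction univ φ) (e x : E n) {ε : ℝ} (hε : 0 < ε) :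
    ∫ z, (‖z‖ ^ 2 + ε) ^ (-(n - 1 + α) / 2) * fderiv ℝ φ (x + z) e =
      (n - 1 + α) * ∫ z, inner ℝ e z * (‖z‖ ^ 2 + ε) ^ (-(n + α + 1) / 2) * (φ (x + z) - φ x) := by
  set r : ℝ := -(n - 1 + α) / 2
  have hr : r - 1 = -(n + α + 1) / 2 := by simp only [r]; ring
  have hf : ∀ z : E n, HasFDerivAt (fun z : E n => (‖z‖ ^ 2 + ε) ^ r) _ z :=
    fun z => hasFDerivAt_regularized_rpow hε r z
  have hfd : ∀ z : E n, fderiv ℝ (fun z : E n => (‖z‖ ^ 2 + ε) ^ r) z e =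
      -(n - 1 + α) * (inner ℝ e z * (‖z‖ ^ 2 + ε) ^ (-(n + α + 1) / 2)) := fun z => by
    rw [(hf z).fderiv, ← hr, smul_apply, smul_eq_mul, innerSL_apply_apply,
      real_inner_comm]
    simp only [r]; ring
  have hψ : IsTestFunction univ (fun z => φ (x + z)) := by
    simpa [add_comm] using h.comp_sub_right (-x)
  have hψd : ∀ z, fderiv ℝ (fun z => φ (x + z)) z e = fderiv ℝ φ (x + z) e := fun z => by
    rw [fderiv_comp_add_left]
  have hcf : Continuous fun z : E n => (‖z‖ ^ 2 + ε) ^ r :=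
    continuous_iff_continuousAt.2 fun z => (hf z).continuousAt
  have hcs : Continuous fun z : E n => inner ℝ e z * (‖z‖ ^ 2 + ε) ^ (-(n + α + 1) / 2) := by
    refine Continuous.mul (by fun_prop) (Continuous.rpow_const (by fun_prop) fun z => Or.inl ?_)
    positivity
  have hodd := integrable_inner_mul_regularized h0 h1 hε e
  have hoddint : ∫ z, inner ℝ e z * (‖z‖ ^ 2 + ε) ^ (-(n + α + 1) / 2) = 0 := by
    have := integral_neg_eq_self
      (fun z : E n => inner ℝ e z * (‖z‖ ^ 2 + ε) ^ (-(n + α + 1) / 2)) volume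
    simp only [inner_neg_right, norm_neg, neg_mul, integral_neg] at this
    linarith
  have hi1 : Integrable fun z => inner ℝ e z * (‖z‖ ^ 2 + ε) ^ (-(n + α + 1) / 2) * φ (x + z) :=
    (hcs.mul hψ.continuous).integrable_of_hasCompactSupport hψ.hasCompactSupport.mul_left
  have := integral_mul_fderiv_eq_neg_fderiv_mul_of_integrable (μ := (volume : Measure (E n)))
    (f := fun z : E n => (‖z‖ ^ 2 + ε) ^ r) (g := fun z => φ (x + z)) (v := e)
    (by
      simp only [hfd]
      exact (hi1.const_mul (-(n - 1 + α))).congr (Eventually.of_forall fun z => by ring))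
    ((hcf.mul ((hψ.smooth.continuous_fderiv (by simp)).clm_apply
        continuous_const)).integrable_of_hasCompactSupport
        (hψ.hasCompactSupport.fderiv_apply ℝ e).mul_left)
    ((hcf.mul hψ.continuous).integrable_of_hasCompactSupport hψ.hasCompactSupport.mul_left)
    (fun z _ => (hf z).differentiableAt)
    (fun _ _ => (hψ.smooth.differentiable (by simp)).differentiableAt)
  simp only [hψd, hfd] at this
  rw [this]
  simp only [mul_sub]
  rw [integral_sub hi1 (hodd.mul_const _), integral_mul_const, hoddint, zero_mul, sub_zero,
    ← integral_const_mul, ← integral_neg]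
  congr 1 with z; ring

/-- The Riesz fractional gradient is the Riesz potential of the gradient. -/
theorem IsTestFunction.integral_rpow_mul_fderiv [NeZero n] {α : ℝ} (h0 : 0 < α) (h1 : α < 1)
    {φ : E n → ℝ} (h : IsTestFunction univ φ) (e x : E n) :
    ∫ z, ‖z‖ ^ (-(n - 1 + α)) * fderiv ℝ φ (x + z) e =
      (n - 1 + α) * diffOp (gradKernel α e) φ x := by
  have hn : (1 : ℝ) ≤ n := by exact_mod_cast Nat.one_le_iff_ne_zero.2 (NeZero.ne n)
  let ε : ℕ → ℝ := fun m => 1 / (m + 1)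
  have hε : ∀ m, 0 < ε m := fun m => by positivity
  have hε0 : Tendsto ε atTop (𝓝 0) := tendsto_one_div_add_atTop_nhds_zero_nat
  have hψ : IsTestFunction univ (fun z => φ (x + z)) := by
    simpa [add_comm] using h.comp_sub_right (-x)
  have hdc : Continuous fun z => fderiv ℝ φ (x + z) e :=
    ((h.smooth.continuous_fderiv (by simp)).comp (continuous_const.add continuous_id)).clm_apply
      continuous_const
  have hdcs : HasCompactSupport fun z => fderiv ℝ φ (x + z) e := by
    have := hψ.hasCompactSupport.fderiv_apply ℝ e
    simpa only [fderiv_comp_add_left] using this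
  have hpt : ∀ (p : ℝ) (z : E n), z ≠ 0 →
      Tendsto (fun m => (‖z‖ ^ 2 + ε m) ^ (-p / 2)) atTop (𝓝 (‖z‖ ^ (-p))) := fun p z hz => by
    have hz' : 0 < ‖z‖ := norm_pos_iff.2 hz
    have e1 : ‖z‖ ^ (-p) = (‖z‖ ^ 2 + 0) ^ (-p / 2) := by
      rw [add_zero, ← Real.rpow_natCast ‖z‖ 2, ← Real.rpow_mul hz'.le]
      congr 1; push_cast; ring
    rw [e1]
    exact (tendsto_const_nhds.add hε0).rpow_const (Or.inl (by positivity))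
  have hae : ∀ᵐ z : E n, z ≠ 0 := Measure.ae_ne volume 0
  -- In both limits the integrand with `ε = 0` dominates, since the exponents are not positive.
  have hlim1 : Tendsto (fun m => ∫ z, (‖z‖ ^ 2 + ε m) ^ (-(n - 1 + α) / 2) *
      fderiv ℝ φ (x + z) e) atTop (𝓝 (∫ z, ‖z‖ ^ (-(n - 1 + α)) * fderiv ℝ φ (x + z) e)) := by
    refine tendsto_integral_of_dominated_convergence
      (fun z => ‖‖z‖ ^ (-(n - 1 + α)) * fderiv ℝ φ (x + z) e‖) (fun m => ?_) ?_ (fun m => ?_) ?_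
    · exact Measurable.aestronglyMeasurable (by fun_prop (disch := assumption))
    · refine Integrable.norm ?_
      simpa only [smul_eq_mul, mul_comm] using
        (locallyIntegrable_norm_rpow (n := n) (p := -(n - 1 + α))
          (by linarith)).integrable_smul_left_of_hasCompactSupport hdc hdcs
    · filter_upwards [hae] with z hz
      have hm := hε m
      rw [norm_mul, norm_mul,
        Real.norm_of_nonneg (by positivity : 0 ≤ (‖z‖ ^ 2 + ε m) ^ (-(n - 1 + α) / 2)),
        Real.norm_of_nonneg (by positivity : 0 ≤ ‖z‖ ^ (-(n - 1 + α)))]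
      gcongr
      refine (regularized_rpow_le (hε m).le (by linarith) hz).trans (le_of_eq ?_)
      congr 1; ring
    · filter_upwards [hae] with z hz
      exact (hpt _ z hz).mul_const _
  obtain ⟨C, hC⟩ := h.exists_supLipschitz
  have hlim2 : Tendsto (fun m => ∫ z, inner ℝ e z * (‖z‖ ^ 2 + ε m) ^ (-(n + α + 1) / 2) *
      (φ (x + z) - φ x)) atTop (𝓝 (diffOp (gradKernel α e) φ x)) := by
    have hφc := h.continuous
    refine tendsto_integral_of_dominated_convergence
      (fun z => ‖gradKernel α e z • (φ (x + z) - φ x)‖) (fun m => ?_) ?_ (fun m => ?_) ?_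
    · exact Measurable.aestronglyMeasurable (by fun_prop)
    · exact (hC.integrable h0 h1 (isKernel_gradKernel α e) x).norm
    · filter_upwards [hae] with z hz
      have hm := hε m
      rw [norm_smul, norm_mul, norm_mul, gradKernel, norm_mul,
        Real.norm_of_nonneg (by positivity : 0 ≤ (‖z‖ ^ 2 + ε m) ^ (-(n + α + 1) / 2)),
        Real.norm_of_nonneg (by positivity : 0 ≤ ‖z‖ ^ (-(n + α + 1)))]
      gcongr
      refine (regularized_rpow_le (hε m).le (by linarith) hz).trans (le_of_eq ?_)
      congr 1; ring
    · filter_upwards [hae] with z hz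
      exact ((hpt _ z hz).const_mul _).mul_const _
  refine tendsto_nhds_unique hlim1 ?_
  simp only [h.regularized_integral_eq h0 h1 e x (hε _)]
  exact hlim2.const_mul _

/-! ### Differences of Riesz kernels -/

/-- The difference `|x-y|^{-(n-1+α)} - |y|^{-(n-1+α)}` of Riesz kernels. -/
noncomputable def rieszKernelDiff (α : ℝ) (x y : E n) : ℝ :=
  ‖x - y‖ ^ (-(n - 1 + α)) - ‖y‖ ^ (-(n - 1 + α))

theorem measurable_rieszKernelDiff (α : ℝ) :
    Measurable fun p : E n × E n => rieszKernelDiff α p.1 p.2 := by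
  unfold rieszKernelDiff; fun_prop

theorem abs_rpow_neg_sub_le {q r a b : ℝ} (hq : 0 ≤ q) (hr : 0 < r) (ha : r ≤ a) (hb : r ≤ b) :
    |a ^ (-q) - b ^ (-q)| ≤ q * r ^ (-q - 1) * |a - b| := by
  have := (convex_Ici r).norm_image_sub_le_of_norm_hasDerivWithin_le (𝕜 := ℝ)
    (f := fun t : ℝ => t ^ (-q)) (f' := fun t => -q * t ^ (-q - 1)) (C := q * r ^ (-q - 1))
    (x := b) (y := a) (fun t ht => (Real.hasDerivAt_rpow_const
      (Or.inl (hr.trans_le ht).ne')).hasDerivWithinAt) (fun t ht => ?_) hb ha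
  · simpa [Real.norm_eq_abs] using this
  · have ht0 : 0 < t := hr.trans_le ht
    rw [norm_mul, Real.norm_eq_abs, abs_neg, abs_of_nonneg hq, Real.norm_of_nonneg (by positivity)]
    exact mul_le_mul_of_nonneg_left (Real.rpow_le_rpow_of_nonpos hr ht (by linarith)) hq

/-- Both singularities have order `q = n - 1 + α < n` and are locally integrable. A single kernel is
not integrable at infinity, but the difference gains one power and decays like `‖y‖ ^ (-(n + α))`.
-/
theorem integrable_rieszKernelDiff_of_norm_eq_one [NeZero n] {α : ℝ} (h0 : 0 < α) (h1 : α < 1)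
    {e : E n} (he : ‖e‖ = 1) : Integrable (rieszKernelDiff α e) := by
  have hn : (1 : ℝ) ≤ n := by exact_mod_cast Nat.one_le_iff_ne_zero.2 (NeZero.ne n)
  set q : ℝ := n - 1 + α
  have hq : 0 ≤ q := by simp only [q]; linarith
  have hm : Measurable (rieszKernelDiff α e) := by
    change Measurable fun y => ‖e - y‖ ^ (-q) - ‖y‖ ^ (-q)
    fun_prop
  rw [← integrableOn_univ, ← union_compl_self (ball (0 : E n) 2)]
  refine IntegrableOn.union ?_ ?_
  · have h5 : IntegrableOn (fun z : E n => ‖z‖ ^ (-q)) (ball 0 2) :=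
      integrableOn_ball_norm_rpow (by simp only [q]; linarith) 2
    have h3 : IntegrableOn (fun z : E n => ‖z‖ ^ (-q)) (ball 0 3) :=
      integrableOn_ball_norm_rpow (by simp only [q]; linarith) 3
    rw [← integrable_indicator_iff measurableSet_ball] at h3
    have h4 := (h3.comp_sub_left e).integrableOn (s := ball 0 2)
    have h6 : IntegrableOn (fun y : E n => ‖e - y‖ ^ (-q)) (ball 0 2) := by
      refine h4.congr_fun (fun y hy => ?_) measurableSet_ball
      rw [mem_ball_zero_iff] at hy
      simp only
      rw [indicator_of_mem]
      rw [mem_ball_zero_iff]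
      calc ‖e - y‖ ≤ ‖e‖ + ‖y‖ := norm_sub_le _ _
        _ < 3 := by rw [he]; linarith
    exact h6.sub h5
  · have hI := (integrable_indicator_norm_rpow (n := n) (p := -q - 1) (R := 1)
      (by simp only [q]; linarith) one_pos).const_mul (q * 2⁻¹ ^ (-q - 1))
    refine (hI.integrableOn (s := (ball 0 2)ᶜ)).mono' hm.aestronglyMeasurable ?_
    rw [ae_restrict_iff' measurableSet_ball.compl]
    refine Eventually.of_forall fun y hy => ?_
    have hy : 2 ≤ ‖y‖ := by simpa using hy
    rw [indicator_of_mem (mem_Ioi.2 (by linarith))]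
    have e1 : ‖y‖ - 1 ≤ ‖e - y‖ := by
      have := norm_sub_norm_le y e
      rw [he, norm_sub_rev] at this; exact this
    have e2 : |‖e - y‖ - ‖y‖| ≤ 1 := by
      have := abs_norm_sub_norm_le (e - y) (-y)
      rwa [norm_neg, sub_neg_eq_add, sub_add_cancel, he] at this
    -- For `‖y‖ ≥ 2` one has `‖e - y‖ ≥ ‖y‖ - 1 ≥ ‖y‖ / 2`.
    have := abs_rpow_neg_sub_le (q := q) (r := 2⁻¹ * ‖y‖) (a := ‖e - y‖) (b := ‖y‖) hq
      (by linarith) (by linarith) (by linarith)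
    rw [Real.norm_eq_abs, rieszKernelDiff]
    refine this.trans ?_
    rw [Real.mul_rpow (by norm_num) (norm_nonneg y), ← mul_assoc]
    exact mul_le_of_le_one_right (by positivity) e2

theorem rieszKernelDiff_smul_isometry (α : ℝ) {t : ℝ} (ht : 0 < t) (R : E n ≃ₗᵢ[ℝ] E n)
    (e y : E n) : rieszKernelDiff α (t • R e) (t • R y) =
      t ^ (-(n - 1 + α)) * rieszKernelDiff α e y := by
  rw [rieszKernelDiff, rieszKernelDiff, ← smul_sub, ← map_sub, norm_smul, norm_smul, R.norm_map,
    R.norm_map, Real.norm_of_nonneg ht.le, Real.mul_rpow ht.le (norm_nonneg _),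
    Real.mul_rpow ht.le (norm_nonneg _), mul_sub]

/-- The difference of Riesz kernels is integrable, with norm homogeneous of degree `1 - α`. -/
theorem exists_integral_abs_rieszKernelDiff_le [NeZero n] {α : ℝ} (h0 : 0 < α) (h1 : α < 1) :
    ∃ C, 0 ≤ C ∧ ∀ x : E n, Integrable (rieszKernelDiff α x) ∧
      ∫ y, |rieszKernelDiff α x y| ≤ C * ‖x‖ ^ (1 - α) := by
  obtain ⟨e, he⟩ := exists_norm_eq_one n
  have hie := integrable_rieszKernelDiff_of_norm_eq_one h0 h1 he
  refine ⟨∫ y, |rieszKernelDiff α e y|, integral_nonneg fun _ => abs_nonneg _, fun x => ?_⟩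
  rcases eq_or_ne x 0 with rfl | hx
  · have : rieszKernelDiff α (0 : E n) = 0 := by
      ext y; simp [rieszKernelDiff]
    rw [this]
    refine ⟨integrable_zero _ _ _, ?_⟩
    simp only [Pi.zero_apply, abs_zero, integral_zero]
    exact mul_nonneg (integral_nonneg fun _ => abs_nonneg _) (by positivity)
  have ht : 0 < ‖x‖ := norm_pos_iff.2 hx
  obtain ⟨R, hR⟩ := exists_isometry_eq (e := ‖x‖ • e) (ξ := x) (by simp [norm_smul, he])
  rw [map_smul] at hR
  have hpt : ∀ y, rieszKernelDiff α x (‖x‖ • R y) =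
      ‖x‖ ^ (-(n - 1 + α)) * rieszKernelDiff α e y := fun y => by
    conv_lhs => rw [← hR]
    rw [norm_smul, norm_norm, R.norm_map, he, mul_one, rieszKernelDiff_smul_isometry α ht]
  constructor
  · rw [← integrable_comp_smul_iff volume _ ht.ne',
      ← R.measurePreserving.integrable_comp_emb R.toHomeomorph.measurableEmbedding]
    exact (hie.const_mul (‖x‖ ^ (-(n - 1 + α)))).congr
      (Eventually.of_forall fun y => (hpt y).symm)
  · have e1 := Measure.integral_comp_smul (volume : Measure (E n))
      (fun y => |rieszKernelDiff α x y|) ‖x‖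
    rw [finrank_euclideanSpace_fin, ← R.measurePreserving.integral_comp
      R.toHomeomorph.measurableEmbedding] at e1
    simp only [hpt, abs_mul, integral_const_mul] at e1
    rw [abs_of_nonneg (by positivity), abs_of_nonneg (by positivity), smul_eq_mul] at e1
    have e2 : ‖x‖ ^ (1 - α) = ‖x‖ ^ n * ‖x‖ ^ (-(n - 1 + α)) := by
      rw [← Real.rpow_natCast, ← Real.rpow_add ht]; congr 1; ring
    rw [e2, mul_comm, mul_assoc, e1]
    refine le_of_eq ?_
    field_simp

/-! ### Riesz potentials of bounded functions -/

/-- The Riesz potential of order `1 - α` of a bounded function, normalised to vanish at `0`. -/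
noncomputable def rieszPotential (α : ℝ) (u : E n → ℝ) (x : E n) : ℝ :=
  rieszConst n α / (n - 1 + α) * ∫ y, u y * rieszKernelDiff α x y

theorem rieszPotential_zero (α : ℝ) (u : E n → ℝ) : rieszPotential α u 0 = 0 := by
  simp [rieszPotential, rieszKernelDiff]

theorem ae_norm_le_of_memLp_top {F : Type*} [NormedAddCommGroup F] {u : E n → F}
    {μ : Measure (E n)} (hu : MemLp u ⊤ μ) : ∃ M : NNReal, ∀ᵐ x ∂μ, ‖u x‖ ≤ M := by
  refine ⟨(eLpNorm u ⊤ μ).toNNReal, ?_⟩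
  rw [eLpNorm_exponent_top]
  have hfin : eLpNormEssSup u μ ≠ ⊤ := by
    rw [← eLpNorm_exponent_top]; exact hu.2.ne
  filter_upwards [enorm_ae_le_eLpNormEssSup u μ] with x hx
  rw [← ENNReal.coe_toNNReal hfin] at hx
  exact_mod_cast hx

theorem integrable_mul_rieszKernelDiff [NeZero n] {α : ℝ} (h0 : 0 < α) (h1 : α < 1) {u : E n → ℝ}
    (hu : MemLp u ⊤ volume) (x : E n) : Integrable fun y => u y * rieszKernelDiff α x y := by
  obtain ⟨C, -, hC⟩ := exists_integral_abs_rieszKernelDiff_le (n := n) h0 h1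
  exact (hC x).1.smul_of_top_right hu

/-- The kernels for `x` and `y` differ by a translate of `rieszKernelDiff α (x - y)`, whose `L¹`
norm is known. Locally this gives continuity; globally it gives sublinear growth, on which
`rieszPotential_periodic` rests. -/
theorem exists_abs_rieszPotential_sub_le [NeZero n] {α : ℝ} (h0 : 0 < α) (h1 : α < 1)
    {u : E n → ℝ} (hu : MemLp u ⊤ volume) :
    ∃ C, ∀ x y, |rieszPotential α u x - rieszPotential α u y| ≤ C * ‖x - y‖ ^ (1 - α) := by
  obtain ⟨C, hC0, hC⟩ := exists_integral_abs_rieszKernelDiff_le (n := n) h0 h1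
  obtain ⟨M, hM⟩ := ae_norm_le_of_memLp_top hu
  refine ⟨|rieszConst n α / (n - 1 + α)| * (M * C), fun x y => ?_⟩
  have hdiff : ∀ z, rieszKernelDiff α x z - rieszKernelDiff α y z =
      rieszKernelDiff α (x - y) (z - y) := fun z => by
    have e1 : x - y - (z - y) = x - z := by abel
    rw [rieszKernelDiff, rieszKernelDiff, rieszKernelDiff, e1, norm_sub_rev z y]
    ring
  rw [rieszPotential, rieszPotential, ← mul_sub, abs_mul, mul_assoc, mul_assoc,
    ← integral_sub (integrable_mul_rieszKernelDiff h0 h1 hu x)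
      (integrable_mul_rieszKernelDiff h0 h1 hu y)]
  gcongr
  calc |∫ z, (u z * rieszKernelDiff α x z - u z * rieszKernelDiff α y z)|
      ≤ ∫ z, M * |rieszKernelDiff α (x - y) (z - y)| := by
        rw [← Real.norm_eq_abs]
        refine norm_integral_le_of_norm_le (((hC (x - y)).1.abs.comp_sub_right y).const_mul _) ?_
        filter_upwards [hM] with z hz
        rw [← mul_sub, norm_mul, hdiff, Real.norm_eq_abs (rieszKernelDiff _ _ _)]
        gcongr
    _ = M * ∫ z, |rieszKernelDiff α (x - y) z| := by
        rw [integral_const_mul,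
          integral_sub_right_eq_self (fun z => |rieszKernelDiff α (x - y) z|) y]
    _ ≤ _ := by gcongr; exact (hC (x - y)).2

theorem continuous_rieszPotential [NeZero n] {α : ℝ} (h0 : 0 < α) (h1 : α < 1)
    {u : E n → ℝ} (hu : MemLp u ⊤ volume) : Continuous (rieszPotential α u) := by
  obtain ⟨C, hC⟩ := exists_abs_rieszPotential_sub_le h0 h1 hu
  refine continuous_iff_continuousAt.2 fun x => ?_
  rw [ContinuousAt, tendsto_iff_dist_tendsto_zero]
  have hlim : Tendsto (fun y => C * ‖y - x‖ ^ (1 - α)) (𝓝 x) (𝓝 0) := by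
    have : Continuous fun y => C * ‖y - x‖ ^ (1 - α) :=
      continuous_const.mul ((by fun_prop : Continuous fun y => ‖y - x‖).rpow_const
        fun y => Or.inr (by linarith))
    have h2 := this.tendsto x
    simpa [Real.zero_rpow (by linarith : 1 - α ≠ 0)] using h2
  exact squeeze_zero (fun _ => dist_nonneg) (fun y => by rw [Real.dist_eq]; exact hC y x) hlim

/-- The Riesz potential intertwines the gradient and the fractional gradient. -/
theorem integral_rieszPotential_mul_fderiv [NeZero n] {α : ℝ} (h0 : 0 < α) (h1 : α < 1)
    {u : E n → ℝ} (hu : MemLp u ⊤ volume) {φ : E n → ℝ} (hφ : IsTestFunction univ φ) (e : E n) :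
    ∫ x, rieszPotential α u x * fderiv ℝ φ x e = ∫ y, u y * inner ℝ e (rieszGradient α φ y) := by
  have hn : (1 : ℝ) ≤ n := by exact_mod_cast Nat.one_le_iff_ne_zero.2 (NeZero.ne n)
  obtain ⟨C, hC0, hC⟩ := exists_integral_abs_rieszKernelDiff_le (n := n) h0 h1
  obtain ⟨M, hM⟩ := ae_norm_le_of_memLp_top hu
  have hdc : Continuous fun z => fderiv ℝ φ z e :=
    (hφ.smooth.continuous_fderiv (by simp)).clm_apply continuous_const
  have hdcs : HasCompactSupport fun z => fderiv ℝ φ z e := hφ.hasCompactSupport.fderiv_apply ℝ e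
  have hdi := hdc.integrable_of_hasCompactSupport (μ := volume) hdcs
  have hint : Integrable (fun p : E n × E n =>
      u p.2 * rieszKernelDiff α p.1 p.2 * fderiv ℝ φ p.1 e) (volume.prod volume) := by
    have hmeas : AEStronglyMeasurable (fun p : E n × E n =>
        u p.2 * rieszKernelDiff α p.1 p.2 * fderiv ℝ φ p.1 e) (volume.prod volume) :=
      (hu.1.comp_snd.mul (measurable_rieszKernelDiff α).aestronglyMeasurable).mul
        (hdc.comp continuous_fst).aestronglyMeasurable
    refine (integrable_prod_iff hmeas).2 ⟨Eventually.of_forall fun x =>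
      (integrable_mul_rieszKernelDiff h0 h1 hu x).mul_const (fderiv ℝ φ x e), ?_⟩
    have hdom : Integrable fun x => M * (C * ‖x‖ ^ (1 - α)) * |fderiv ℝ φ x e| := by
      refine Continuous.integrable_of_hasCompactSupport (Continuous.mul ?_ hdc.abs)
        (hdcs.abs.mul_left)
      exact continuous_const.mul (continuous_const.mul (continuous_norm.rpow_const
        fun y => Or.inr (by linarith)))
    refine hdom.mono' hmeas.norm.integral_prod_right' (Eventually.of_forall fun x => ?_)
    rw [Real.norm_of_nonneg (integral_nonneg fun _ => norm_nonneg _)]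
    simp only [norm_mul, integral_mul_const]
    rw [Real.norm_eq_abs (fderiv ℝ φ x e)]
    gcongr
    calc ∫ y, ‖u y‖ * ‖rieszKernelDiff α x y‖ ≤ ∫ y, M * |rieszKernelDiff α x y| := by
          refine integral_mono_of_nonneg (Eventually.of_forall fun y => by positivity)
            ((hC x).1.abs.const_mul _) ?_
          filter_upwards [hM] with y hy
          rw [Real.norm_eq_abs (rieszKernelDiff α x y)]
          gcongr
      _ ≤ _ := by
          rw [integral_const_mul]; gcongr; exact (hC x).2
  -- The normalising term does not depend on `x` and integrates to zero against a derivative, which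
  -- leaves the Riesz potential of `∇φ`.
  have hinner : ∀ y, ∫ x, rieszKernelDiff α x y * fderiv ℝ φ x e =
      (n - 1 + α) * diffOp (gradKernel α e) φ y := fun y => by
    have hψ := hdc.comp (continuous_const_add y)
    have hψs : HasCompactSupport fun z => fderiv ℝ φ (y + z) e :=
      hdcs.comp_homeomorph (Homeomorph.addLeft y)
    have i1 : Integrable fun x => ‖x - y‖ ^ (-(n - 1 + α)) * fderiv ℝ φ x e := by
      have := (locallyIntegrable_norm_rpow (n := n) (p := -(n - 1 + α))
          (by linarith)).integrable_smul_left_of_hasCompactSupport hψ hψs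
      have := this.comp_sub_right y
      simpa only [Function.comp_apply, add_sub_cancel, smul_eq_mul, mul_comm] using this
    simp only [rieszKernelDiff, sub_mul]
    rw [integral_sub i1 (hdi.const_mul _), integral_const_mul, integral_fderiv_eq_zero hφ,
      mul_zero, sub_zero, ← hφ.integral_rpow_mul_fderiv h0 h1 e y,
      ← integral_add_left_eq_self _ y]
    simp only [add_sub_cancel_left]
  calc ∫ x, rieszPotential α u x * fderiv ℝ φ x e
      = rieszConst n α / (n - 1 + α) *
          ∫ x, ∫ y, u y * rieszKernelDiff α x y * fderiv ℝ φ x e := by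
        rw [← integral_const_mul]
        congr 1 with x
        rw [integral_mul_const, rieszPotential]; ring
    _ = rieszConst n α / (n - 1 + α) *
          ∫ y, ∫ x, u y * rieszKernelDiff α x y * fderiv ℝ φ x e := by
        rw [integral_integral_swap hint]
    _ = _ := by
        rw [← integral_const_mul]
        congr 1 with y
        simp only [mul_assoc, integral_const_mul]
        rw [hinner, inner_rieszGradient_test h0 h1 hφ]
        have : (n : ℝ) - 1 + α ≠ 0 := by linarith
        field_simp

theorem HasWeakFracGradient.hasWeakGradient_rieszPotential [NeZero n] {α : ℝ} (h0 : 0 < α)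
    (h1 : α < 1) {u : E n → ℝ} (hu : MemLp u ⊤ volume) {G : E n → E n}
    (h : HasWeakFracGradient α u G) : HasWeakGradient univ (rieszPotential α u) G := by
  have hl1 := (continuous_rieszPotential h0 h1 hu).locallyIntegrable.locallyIntegrableOn
    (μ := volume) univ
  have hl2 := h.locallyIntegrable.locallyIntegrableOn univ
  refine ⟨hl1, hl2, fun φ hφ => (integral_smul_eq_iff_inner hφ hl1 hl2).2 fun e => ?_⟩
  rw [setIntegral_univ, setIntegral_univ, integral_rieszPotential_mul_fderiv h0 h1 hu hφ]
  exact (integral_smul_eq_neg_iff_inner (hφ.integrable_smul hl2)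
    (integrable_smul_rieszGradient h0 h1 hφ hu)).1 (h.integral_eq φ hφ) e

theorem rieszGradient_comp_sub_right (α : ℝ) (φ : E n → ℝ) (a x : E n) :
    rieszGradient α (fun y => φ (y - a)) x = rieszGradient α φ (x - a) := by
  have := integral_sub_right_eq_self (μ := (volume : Measure (E n))) (fun y =>
    ((φ y - φ (x - a)) / ‖y - (x - a)‖ ^ ((n : ℝ) + α)) •
      (‖y - (x - a)‖⁻¹ • (y - (x - a)))) a
  rw [rieszGradient, rieszGradient, ← this]
  simp only [sub_sub_sub_cancel_right]

/-- The increment of the potential over `a` has zero weak gradient, hence is a constant `D 0`. The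
potential at `k • a` is then `k * D 0`, and growth of order `k ^ (1 - α)` forces `D 0 = 0`. -/
theorem rieszPotential_periodic [NeZero n] {α : ℝ} (h0 : 0 < α) (h1 : α < 1) {u : E n → ℝ}
    (hu : MemLp u ⊤ volume) {a : E n} (ha : (fun x => u (x + a)) =ᵐ[volume] u) (x : E n) :
    rieszPotential α u (x + a) = rieszPotential α u x := by
  set V := rieszPotential α u
  have hV : Continuous V := continuous_rieszPotential h0 h1 hu
  have hVa : Continuous fun x => V (x + a) := hV.comp (continuous_add_const a)
  set D : E n → ℝ := fun x => V (x + a) - V x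
  have hD : Continuous D := hVa.sub hV
  have hl1 := hD.locallyIntegrable.locallyIntegrableOn (μ := volume) univ
  have hl2 : LocallyIntegrableOn (fun _ : E n => (0 : E n)) univ volume :=
    continuous_const.locallyIntegrable.locallyIntegrableOn univ
  -- The normalisation at `0` is not translation invariant, so the potential is compared with its
  -- translate only after testing against derivatives, where the normalisation drops out.
  have hw : HasWeakGradient univ D fun _ => 0 := by
    refine ⟨hl1, hl2, fun φ hφ => (integral_smul_eq_iff_inner hφ hl1 hl2).2 fun e => ?_⟩
    have hdc : Continuous fun z => fderiv ℝ φ z e :=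
      (hφ.smooth.continuous_fderiv (by simp)).clm_apply continuous_const
    have hdcs : HasCompactSupport fun z => fderiv ℝ φ z e := hφ.hasCompactSupport.fderiv_apply ℝ e
    have hφa := hφ.comp_sub_right a
    have key : ∫ x, V (x + a) * fderiv ℝ φ x e = ∫ x, V x * fderiv ℝ φ x e := by
      calc ∫ x, V (x + a) * fderiv ℝ φ x e
          = ∫ x, V x * fderiv ℝ (fun y => φ (y - a)) x e := by
            rw [← integral_add_right_eq_self (fun x => V x * fderiv ℝ (fun y => φ (y - a)) x e) a]
            simp only [fderiv_comp_sub, add_sub_cancel_right]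
        _ = ∫ y, u y * inner ℝ e (rieszGradient α φ (y - a)) := by
            rw [integral_rieszPotential_mul_fderiv h0 h1 hu hφa]
            simp only [rieszGradient_comp_sub_right]
        _ = ∫ y, u (y + a) * inner ℝ e (rieszGradient α φ y) := by
            rw [← integral_add_right_eq_self _ a]
            simp only [add_sub_cancel_right]
        _ = ∫ y, u y * inner ℝ e (rieszGradient α φ y) :=
            integral_congr_ae (ha.mono fun y hy => by simp only at hy ⊢; rw [hy])
        _ = _ := (integral_rieszPotential_mul_fderiv h0 h1 hu hφ e).symm
    have i1 : Integrable fun x => V (x + a) * fderiv ℝ φ x e :=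
      (hVa.mul hdc).integrable_of_hasCompactSupport hdcs.mul_left
    have i2 : Integrable fun x => V x * fderiv ℝ φ x e :=
      (hV.mul hdc).integrable_of_hasCompactSupport hdcs.mul_left
    simp only [inner_zero_right, mul_zero, integral_zero, D, sub_mul]
    rw [setIntegral_univ, integral_sub i1 i2, key, sub_self, neg_zero]
  have hconst : ∀ x, V (x + a) = V x + D 0 := fun x => by
    have hL := hw.lipschitzWith (L := 0) hD (Eventually.of_forall fun x => by simp)
    have := hL.dist_le_mul x 0
    rw [NNReal.coe_zero, zero_mul, dist_le_zero] at this
    simp only [← this, D]; ring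
  have hiter : ∀ k : ℕ, V ((k : ℝ) • a) = k * D 0 := fun k => by
    induction k with
    | zero => simp [V, rieszPotential_zero]
    | succ k ih =>
      push_cast
      rw [add_smul, one_smul, hconst, ih]; ring
  obtain ⟨C, hC⟩ := exists_abs_rieszPotential_sub_le h0 h1 hu
  -- The Hölder bound between `(k + 1) • a` and `0`, divided by `k + 1`.
  have hb : ∀ k : ℕ, |D 0| ≤ C * ‖a‖ ^ (1 - α) * ((k : ℝ) + 1) ^ (-α) := fun k => by
    have hk : (0 : ℝ) < k + 1 := by positivity
    have h2 := hC (((k + 1 : ℕ) : ℝ) • a) 0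
    rw [rieszPotential_zero, sub_zero, sub_zero, norm_smul] at h2
    change |V _| ≤ _ at h2
    rw [hiter, abs_mul] at h2
    push_cast at h2
    rw [abs_of_pos hk, Real.norm_of_nonneg hk.le, Real.mul_rpow hk.le (norm_nonneg a),
      sub_eq_add_neg, Real.rpow_add hk, Real.rpow_one] at h2
    refine le_of_mul_le_mul_left (h2.trans (le_of_eq ?_)) hk
    rw [sub_eq_add_neg]; ring
  have hlim : Tendsto (fun k : ℕ => C * ‖a‖ ^ (1 - α) * ((k : ℝ) + 1) ^ (-α)) atTop (𝓝 0) := by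
    have := ((tendsto_rpow_neg_atTop h0).comp
      (tendsto_atTop_add_const_right _ (1 : ℝ) tendsto_natCast_atTop_atTop)).const_mul
        (C * ‖a‖ ^ (1 - α))
    simpa using this
  have hd : D 0 = 0 := abs_nonpos_iff.1 (ge_of_tendsto' hlim hb)
  rw [hconst, hd, add_zero]

/-! ### The unit cube -/

theorem unitCube_eq_preimage (n : ℕ) :
    unitCube n = PiLp.homeomorph 2 (fun _ : Fin n => ℝ) ⁻¹' (univ.pi fun _ => Ioo 0 1) := by
  ext x; simp [unitCube, PiLp.homeomorph]

theorem isOpen_unitCube (n : ℕ) : IsOpen (unitCube n) := by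
  rw [unitCube_eq_preimage]
  exact (isOpen_set_pi finite_univ fun _ _ => isOpen_Ioo).preimage (Homeomorph.continuous _)

theorem measurableSet_unitCube (n : ℕ) : MeasurableSet (unitCube n) :=
  (isOpen_unitCube n).measurableSet

theorem convex_unitCube (n : ℕ) : Convex ℝ (unitCube n) := by
  intro x hx y hy a b ha hb hab i
  exact convex_Ioo 0 1 (hx i) (hy i) ha hb hab

theorem mem_closure_unitCube {x : E n} : x ∈ closure (unitCube n) ↔ ∀ i, x i ∈ Icc (0 : ℝ) 1 := by
  rw [unitCube_eq_preimage, ← Homeomorph.preimage_closure, closure_pi_set]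
  simp only [closure_Ioo (zero_ne_one (α := ℝ)), mem_preimage, mem_univ_pi]; rfl

theorem mem_frontier_unitCube {x : E n} (hx : ∀ i, x i ∈ Icc (0 : ℝ) 1) {i : Fin n}
    (hi : x i = 0 ∨ x i = 1) : x ∈ frontier (unitCube n) := by
  rw [frontier, (isOpen_unitCube n).interior_eq]
  refine ⟨mem_closure_unitCube.2 hx, fun h => ?_⟩
  have := h i
  rcases hi with h0 | h0 <;> rw [h0] at this <;> simp at this

theorem volume_unitCube (n : ℕ) : volume (unitCube n) = 1 := by
  have h : unitCube n = WithLp.ofLp ⁻¹' (univ.pi fun _ : Fin n => Ioo (0 : ℝ) 1) := by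
    ext x; simp [unitCube]
  rw [h, (PiLp.volume_preserving_ofLp (Fin n)).measure_preimage
    (MeasurableSet.univ_pi fun _ => measurableSet_Ioo).nullMeasurableSet, Real.volume_pi_Ioo]
  simp

theorem isCompact_closure_unitCube (n : ℕ) : IsCompact (closure (unitCube n)) := by
  have : closure (unitCube n) =
      PiLp.homeomorph 2 (fun _ : Fin n => ℝ) ⁻¹' (univ.pi fun _ => Icc 0 1) := by
    ext x; rw [mem_closure_unitCube]; simp only [mem_preimage, mem_univ_pi]; rfl
  rw [this]
  exact (Homeomorph.isCompact_preimage _).2 (isCompact_univ_pi fun _ => isCompact_Icc)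

theorem abs_apply_le_norm (x : E n) (i : Fin n) : |x i| ≤ ‖x‖ := by
  rw [← Real.norm_eq_abs]; exact PiLp.norm_apply_le x i

/-! ### Periodic extensions -/

/-- The point of `[0,1)ⁿ` congruent to `x` modulo `ℤⁿ`. -/
noncomputable def fractVec (x : E n) : E n := WithLp.toLp 2 fun i => Int.fract (x i)

theorem fractVec_apply (x : E n) (i : Fin n) : fractVec x i = Int.fract (x i) := rfl

theorem fractVec_mem (x : E n) : fractVec x ∈ closure (unitCube n) :=
  mem_closure_unitCube.2 fun _ => ⟨Int.fract_nonneg _, (Int.fract_lt_one _).le⟩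

theorem fractVec_of_mem {x : E n} (hx : x ∈ unitCube n) : fractVec x = x := by
  ext i
  exact Int.fract_eq_self.2 ⟨(hx i).1.le, (hx i).2⟩

theorem fractVec_add_single (x : E n) (i : Fin n) :
    fractVec (x + EuclideanSpace.single i (1 : ℝ)) = fractVec x := by
  ext j
  rw [fractVec_apply, fractVec_apply, PiLp.add_apply]
  rcases eq_or_ne j i with rfl | h
  · rw [PiLp.single_apply, if_pos rfl, Int.fract_add_one]
  · rw [PiLp.single_apply, if_neg h, add_zero]

section

variable {w : E n → ℝ} {L : NNReal}

/-- Moving `x` parallel to the `i`-th axis onto the face where that coordinate is `t` reaches a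
boundary point, at which `w` vanishes. -/
theorem abs_le_of_zero_frontier (hL : LipschitzOnWith L w (closure (unitCube n)))
    (h0 : ∀ x ∈ frontier (unitCube n), w x = 0) {x : E n} (hx : x ∈ closure (unitCube n))
    (i : Fin n) {t : ℝ} (ht : t = 0 ∨ t = 1) : |w x| ≤ L * |t - x i| := by
  set p : E n := x + EuclideanSpace.single i (t - x i)
  have hpi : p i = t := by simp [p]
  have hp : ∀ j, p j ∈ Icc (0 : ℝ) 1 := fun j => by
    rcases eq_or_ne j i with rfl | h
    · rw [hpi]; rcases ht with rfl | rfl <;> simp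
    · have : p j = x j := by simp [p, h]
      rw [this]; exact mem_closure_unitCube.1 hx j
  have hwp : w p = 0 := h0 p (mem_frontier_unitCube hp (i := i) (by rw [hpi]; exact ht))
  have := hL.dist_le_mul p (mem_closure_unitCube.2 hp) x hx
  rw [hwp, dist_eq_norm, dist_eq_norm, zero_sub, norm_neg, add_sub_cancel_left,
    PiLp.norm_single] at this
  exact this

/-- Within one lattice cell the bound is that of `w`. Otherwise an integer separates the `i`-th
coordinates for some `i`; the distances of the two reduced points to the opposite faces then add up
to at most `dist x y`, and each value is bounded by `L` times such a distance. -/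
theorem lipschitzWith_comp_fractVec (hL : LipschitzOnWith L w (closure (unitCube n)))
    (h0 : ∀ x ∈ frontier (unitCube n), w x = 0) : LipschitzWith L fun x => w (fractVec x) := by
  have key : ∀ x y : E n, ∀ i, ⌊x i⌋ < ⌊y i⌋ →
      |w (fractVec x)| + |w (fractVec y)| ≤ L * dist x y := by
    intro x y i hi
    have h1 := abs_le_of_zero_frontier hL h0 (fractVec_mem x) i (Or.inr rfl)
    have h2 := abs_le_of_zero_frontier hL h0 (fractVec_mem y) i (Or.inl rfl)
    rw [fractVec_apply,
      abs_of_nonneg (a := 1 - Int.fract (x i)) (by linarith [Int.fract_lt_one (x i)])] at h1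
    rw [fractVec_apply, zero_sub, abs_neg,
      abs_of_nonneg (a := Int.fract (y i)) (Int.fract_nonneg _)] at h2
    have h3 : (⌊x i⌋ : ℝ) + 1 ≤ ⌊y i⌋ := by exact_mod_cast hi
    have h4 : y i - x i ≤ dist x y := by
      rw [dist_comm, dist_eq_norm]
      exact (le_abs_self _).trans (abs_apply_le_norm (y - x) i)
    have h5 : (1 - Int.fract (x i)) + Int.fract (y i) ≤ dist x y := by
      rw [← Int.self_sub_floor, ← Int.self_sub_floor]; linarith
    calc _ ≤ L * (1 - Int.fract (x i)) + L * Int.fract (y i) := add_le_add h1 h2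
      _ = L * ((1 - Int.fract (x i)) + Int.fract (y i)) := by ring
      _ ≤ _ := by gcongr
  refine LipschitzWith.of_dist_le_mul fun x y => ?_
  by_cases h : ∀ i, ⌊x i⌋ = ⌊y i⌋
  · have hd : fractVec x - fractVec y = x - y := by
      ext i
      simp only [PiLp.sub_apply, fractVec_apply, ← Int.self_sub_floor, h i]
      ring
    have := hL.dist_le_mul _ (fractVec_mem x) _ (fractVec_mem y)
    rwa [dist_eq_norm (fractVec x), hd, ← dist_eq_norm] at this
  · push Not at h
    obtain ⟨i, hi⟩ := h
    rw [Real.dist_eq]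
    refine (abs_sub _ _).trans ?_
    rcases lt_or_gt_of_ne hi with hi | hi
    · exact key x y i hi
    · rw [dist_comm, add_comm]; exact key y x i hi

end

/-- The periodic extension of a function in `W^{1,∞}_0(Q)` is Lipschitz. -/
theorem exists_periodic_lipschitz_extension {u : E n → ℝ} (hu : MemW1Infty (unitCube n) u)
    (h0 : HasZeroTrace (unitCube n) u) :
    ∃ (W : E n → ℝ) (K : NNReal) (M : ℝ), LipschitzWith K W ∧ (∀ x, |W x| ≤ M) ∧
      (∀ i x, W (x + EuclideanSpace.single i (1 : ℝ)) = W x) ∧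
      u =ᵐ[volume.restrict (unitCube n)] W := by
  obtain ⟨-, v, hv, hvb⟩ := hu
  obtain ⟨w, hwc, huw, hw0⟩ := h0
  obtain ⟨L, hL⟩ := ae_norm_le_of_memLp_top hvb
  -- Mollification requires local integrability on the whole space, while `w` is controlled only on
  -- the closed cube.
  set w' := (closure (unitCube n)).indicator w
  have hww' : EqOn w' w (closure (unitCube n)) := fun x hx => indicator_of_mem hx w
  have hw'i : Integrable w' :=
    (integrable_indicator_iff isClosed_closure.measurableSet).2
      (hwc.integrableOn_compact (isCompact_closure_unitCube n))
  have huw' : u =ᵐ[volume.restrict (unitCube n)] w' := by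
    filter_upwards [huw, ae_restrict_mem (measurableSet_unitCube n)] with x hx hxU
    rw [hx, hww' (subset_closure hxU)]
  have hLip : LipschitzOnWith L w' (unitCube n) :=
    (hv.congr huw' (ae_eq_refl v)).lipschitzOnWith (isOpen_unitCube n) (convex_unitCube n)
      hw'i.locallyIntegrable ((hwc.congr hww').mono subset_closure) hL
  have hLipc : LipschitzOnWith L w (closure (unitCube n)) :=
    fun x hx y hy => by
      rw [← hww' hx, ← hww' hy]; exact hLip.closure (hwc.congr hww') hx hy
  obtain ⟨M, hM⟩ := (isCompact_closure_unitCube n).exists_bound_of_continuousOn hwc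
  refine ⟨fun x => w (fractVec x), L, M, lipschitzWith_comp_fractVec hLipc hw0,
    fun x => hM _ (fractVec_mem x), fun i x => by simp only [fractVec_add_single], ?_⟩
  filter_upwards [huw, ae_restrict_mem (measurableSet_unitCube n)] with x hx hxU
  rw [hx, fractVec_of_mem hxU]

/-! ### From `α`-quasiconvexity to quasiconvexity -/

theorem IsAlphaQuasiconvex.isQuasiconvex {m : ℕ} [NeZero n] {α : ℝ} (h0 : 0 < α) (h1 : α < 1)
    {h : Matrix (Fin m) (Fin n) ℝ → ℝ} (hh : IsAlphaQuasiconvex α h) : IsQuasiconvex h := by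
  intro A u G hu hG
  choose W K M hK hM hper hae using fun j => exists_periodic_lipschitz_extension (hu j).1 (hu j).2
  obtain ⟨c, hc⟩ := exists_fracPotential (n := n) h0 h1
  choose hmem hfrac using fun j => hc (W j) (K j) (M j) (hK j) (hM j)
  set G' : E n → Matrix (Fin m) (Fin n) ℝ := fun x => Matrix.of fun j i => gradient (W j) x i
  have hrow : ∀ j, row G' j = gradient (W j) := fun j => rfl
  -- The given field `G` carries information only on the cube; there, uniqueness of weak gradients
  -- identifies it with the gradient of the periodic extension.
  have hGG' : ∀ᵐ x ∂volume.restrict (unitCube n), G' x = G x := by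
    have : ∀ j, gradient (W j) =ᵐ[volume.restrict (unitCube n)] row G j := fun j =>
      (hasWeakGradient_of_lipschitzWith (hK j) (unitCube n)).ae_eq (isOpen_unitCube n)
        ((hG j).congr (hae j) (ae_eq_refl _))
    filter_upwards [ae_all_iff.2 this] with x hx
    ext j i
    have := congrArg (fun v : E n => v i) (hx j)
    exact this
  obtain ⟨hi, hle⟩ := hh A
    (fun x => WithLp.toLp 2 fun j => c * diffOp (lapKernel (1 - α)) (W j) x) G'
    ⟨fun j => ⟨hmem j, gradient (W j), hfrac j, memLp_top_gradient (hK j) volume⟩,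
      fun i => Eventually.of_forall fun x => by
        simp only [fun j => diffOp_periodic (κ := lapKernel (1 - α)) (hper j i) x]⟩
    fun j => by rw [hrow]; exact hfrac j
  have hcongr : (fun y => h (A + G' y)) =ᵐ[volume.restrict (unitCube n)] fun y => h (A + G y) := by
    filter_upwards [hGG'] with y hy
    rw [hy]
  exact ⟨hi.congr hcongr, hle.trans_eq (integral_congr_ae hcongr)⟩

/-! ### Integrals of rescaled periodic functions -/

/-- Identify the unit interval with the circle, where multiplication by `N` preserves Haar measure.
-/
theorem measurePreserving_fract_mul {N : ℕ} (hN : N ≠ 0) :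
    MeasurePreserving (fun t : ℝ => Int.fract (N * t)) (volume.restrict (Ioo 0 1))
      (volume.restrict (Ioo 0 1)) := by
  set μ : Measure ℝ := volume.restrict (Ioo 0 1)
  have hmk : MeasurePreserving (fun t : ℝ => (t : AddCircle (1 : ℝ))) μ volume := by
    have := AddCircle.measurePreserving_mk 1 0
    rwa [zero_add, ← Measure.restrict_congr_set (μ := volume) Ioo_ae_eq_Ioc] at this
  have hns : MeasurePreserving (fun p : AddCircle (1 : ℝ) => N • p) volume volume := by
    -- The case `N = 1` is separate because the identity is not ergodic.
    rcases (Nat.one_le_iff_ne_zero.2 hN).eq_or_lt with h | h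
    · subst h; simp only [one_smul]; exact MeasurePreserving.id _
    · exact (AddCircle.ergodic_nsmul h).toMeasurePreserving
  set g : AddCircle (1 : ℝ) → ℝ := fun p => (AddCircle.equivIco 1 0 p : ℝ)
  have hg : Measurable g := measurable_subtype_coe.comp (AddCircle.measurableEquivIco 1 0).measurable
  have hgf : ∀ t : ℝ, g (t : AddCircle (1 : ℝ)) = Int.fract t := fun t => by
    simp [g, AddCircle.coe_equivIco_mk_apply]
  have hgm : Measure.map g volume = μ := by
    rw [← hmk.map_eq, Measure.map_map hg hmk.measurable]
    have : g ∘ (fun t : ℝ => (t : AddCircle (1 : ℝ))) =ᵐ[μ] id := by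
      filter_upwards [ae_restrict_mem measurableSet_Ioo] with t ht
      rw [Function.comp_apply, hgf, id, Int.fract_eq_self.2 ⟨ht.1.le, ht.2⟩]
    rw [Measure.map_congr this, Measure.map_id]
  have hgp : MeasurePreserving g volume μ := ⟨hg, hgm⟩
  have := hgp.comp (hns.comp hmk)
  have heq : (fun t : ℝ => Int.fract (N * t)) =
      g ∘ (fun p : AddCircle (1 : ℝ) => N • p) ∘ fun t : ℝ => (t : AddCircle (1 : ℝ)) := by
    funext t
    rw [Function.comp_apply, Function.comp_apply, ← hgf, ← nsmul_eq_mul]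
    rfl
  rw [heq]
  exact this

theorem measurePreserving_fractVec_smul {N : ℕ} (hN : N ≠ 0) :
    MeasurePreserving (fun x : E n => fractVec ((N : ℝ) • x)) (volume.restrict (unitCube n))
      (volume.restrict (unitCube n)) := by
  set ν : Measure (Fin n → ℝ) := Measure.pi fun _ => volume.restrict (Ioo 0 1)
  have hν : ν = volume.restrict (univ.pi fun _ : Fin n => Ioo (0 : ℝ) 1) := by
    rw [volume_pi, Measure.restrict_pi_pi]
  have h : unitCube n = WithLp.ofLp ⁻¹' (univ.pi fun _ : Fin n => Ioo (0 : ℝ) 1) := by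
    ext x; simp [unitCube]
  have hms : MeasurableSet (univ.pi fun _ : Fin n => Ioo (0 : ℝ) 1) :=
    MeasurableSet.univ_pi fun _ => measurableSet_Ioo
  have h1 : MeasurePreserving (WithLp.ofLp : E n → Fin n → ℝ) (volume.restrict (unitCube n)) ν := by
    rw [hν, h]
    exact (PiLp.volume_preserving_ofLp (Fin n)).restrict_preimage hms
  have h2 : MeasurePreserving (WithLp.toLp 2 : (Fin n → ℝ) → E n) ν
      (volume.restrict (unitCube n)) := by
    have := (PiLp.volume_preserving_toLp (Fin n)).restrict_preimage (measurableSet_unitCube n)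
    rw [h] at this
    rw [hν, h]
    exact this
  have h3 : MeasurePreserving (fun x : Fin n → ℝ => fun i => Int.fract (N * x i)) ν ν :=
    measurePreserving_pi _ _ fun _ => measurePreserving_fract_mul hN
  exact h2.comp (h3.comp h1)

theorem apply_fractVec {X : Type*} {F : E n → X}
    (hF : ∀ i x, F (x + EuclideanSpace.single i (1 : ℝ)) = F x) (x : E n) :
    F (fractVec x) = F x := by
  have hnat : ∀ (k : ℕ) i x, F (x + (k : ℝ) • EuclideanSpace.single i (1 : ℝ)) = F x := by
    intro k i
    induction k with
    | zero => simp
    | succ k ih =>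
      intro x
      push_cast
      rw [add_smul, one_smul, ← add_assoc, hF, ih]
  have hint : ∀ (k : ℤ) i x, F (x + (k : ℝ) • EuclideanSpace.single i (1 : ℝ)) = F x := by
    intro k i x
    obtain ⟨m, rfl | rfl⟩ := k.eq_nat_or_neg
    · exact_mod_cast hnat m i x
    · rw [← hnat m i (x + _)]
      push_cast
      rw [add_assoc, neg_smul, neg_add_cancel, add_zero]
  have hsum : ∀ (c : Fin n → ℤ) (s : Finset (Fin n)) (x : E n),
      F (x + ∑ i ∈ s, (c i : ℝ) • EuclideanSpace.single i (1 : ℝ)) = F x := by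
    intro c s x
    induction s using Finset.induction_on generalizing x with
    | empty => simp
    | insert i s hi ih => rw [Finset.sum_insert hi, ← add_assoc, ih, hint]
  rw [← hsum (fun i => ⌊x i⌋) Finset.univ (fractVec x)]
  congr 1
  ext j
  simp [fractVec_apply, Pi.single_apply]

theorem setIntegral_unitCube_comp_smul {N : ℕ} (hN : N ≠ 0) {F : E n → ℝ} (hFm : Measurable F)
    (hF : ∀ i x, F (x + EuclideanSpace.single i (1 : ℝ)) = F x) :
    ∫ x in unitCube n, F ((N : ℝ) • x) = ∫ x in unitCube n, F x := by
  have h := measurePreserving_fractVec_smul (n := n) hN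
  calc _ = ∫ x in unitCube n, F (fractVec ((N : ℝ) • x)) := by simp only [apply_fractVec hF]
    _ = ∫ x, F x ∂Measure.map (fun x : E n => fractVec ((N : ℝ) • x))
          (volume.restrict (unitCube n)) :=
        (integral_map h.measurable.aemeasurable hFm.aestronglyMeasurable).symm
    _ = _ := by rw [h.map_eq]

/-! ### Lipschitz test fields for quasiconvexity -/

/-- The matrix field whose rows are the gradients of the components. -/
noncomputable def jacobian {m : ℕ} (f : Fin m → E n → ℝ) (x : E n) : Matrix (Fin m) (Fin n) ℝ :=
  Matrix.of fun j i => gradient (f j) x i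

theorem memW1Infty_of_lipschitzWith {f : E n → ℝ} {K : NNReal} (hf : LipschitzWith K f) :
    MemW1Infty (unitCube n) f := by
  obtain ⟨M, hM⟩ := (isCompact_closure_unitCube n).exists_bound_of_continuousOn
    hf.continuous.continuousOn
  refine ⟨memLp_top_of_bound hf.continuous.aestronglyMeasurable M ?_, gradient f,
    hasWeakGradient_of_lipschitzWith hf _, memLp_top_gradient hf _⟩
  filter_upwards [ae_restrict_mem (measurableSet_unitCube n)] with x hx
  exact hM x (subset_closure hx)

theorem IsQuasiconvex.le_setIntegral_jacobian {m : ℕ} {h : Matrix (Fin m) (Fin n) ℝ → ℝ}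
    (hq : IsQuasiconvex h) (A : Matrix (Fin m) (Fin n) ℝ) {f : Fin m → E n → ℝ}
    {K : Fin m → NNReal} (hf : ∀ j, LipschitzWith (K j) (f j))
    (h0 : ∀ j, ∀ x ∉ unitCube n, f j x = 0) :
    IntegrableOn (fun y => h (A + jacobian f y)) (unitCube n) volume ∧
      h A ≤ ∫ y in unitCube n, h (A + jacobian f y) := by
  refine hq A (fun x => WithLp.toLp 2 fun j => f j x) (jacobian f) (fun j => ⟨?_, ?_⟩) fun j => ?_
  · exact memW1Infty_of_lipschitzWith (hf j)
  · refine ⟨f j, (hf j).continuous.continuousOn, ae_eq_refl _, fun x hx => h0 j x fun hxU => ?_⟩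
    rw [frontier, (isOpen_unitCube n).interior_eq] at hx
    exact hx.2 hxU
  · exact hasWeakGradient_of_lipschitzWith (hf j) _

/-! ### Local boundedness of quasiconvex functions -/

/-- Lipschitz functions with disjoint supports can be added. -/
theorem lipschitzWith_tsum_of_disjoint {X : Type*} [PseudoMetricSpace X] {f : ℕ → X → ℝ}
    {K : NNReal} (hf : ∀ k, LipschitzWith K (f k))
    (hd : ∀ k l x, f k x ≠ 0 → f l x ≠ 0 → k = l) :
    LipschitzWith (2 * K) fun x => ∑' k, f k x := by
  have hk : ∀ x, ∃ k, ∀ l, l ≠ k → f l x = 0 := fun x => by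
    by_cases h : ∃ k, f k x ≠ 0
    · obtain ⟨k, hk⟩ := h
      exact ⟨k, fun l hl => by_contra fun h' => hl (hd l k x h' hk)⟩
    · push Not at h
      exact ⟨0, fun l _ => h l⟩
  choose k hk using hk
  have hs : ∀ x, ∑' l, f l x = f (k x) x := fun x => tsum_eq_single (k x) (hk x)
  refine LipschitzWith.of_dist_le_mul fun x y => ?_
  simp only [hs]
  have h1 := (hf (k x)).dist_le_mul x y
  have h2 := (hf (k y)).dist_le_mul x y
  have h3 : 0 ≤ K * dist x y := by positivity
  push_cast
  -- If the active indices differ, each function vanishes at the other point, so the two values are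
  -- bounded separately; hence the factor 2.
  by_cases hxy : k x = k y
  · rw [← hxy]; linarith
  · rw [hk y _ hxy, Real.dist_eq, sub_zero] at h1
    rw [hk x _ (Ne.symm hxy), Real.dist_eq, zero_sub, abs_neg] at h2
    rw [Real.dist_eq]
    linarith [abs_sub (f (k x) x) (f (k y) y)]

/-- The linear function `⟪b, · - c⟫`, truncated so as to vanish outside `ball c r`. -/
noncomputable def truncLinear (R r : ℝ) (b c x : E n) : ℝ :=
  max (-(R * max 0 (r - ‖x - c‖))) (min (R * max 0 (r - ‖x - c‖)) (inner ℝ b (x - c)))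

theorem lipschitzWith_truncLinear {R : NNReal} (r : ℝ) {b : E n} (c : E n) (hb : ‖b‖ ≤ R) :
    LipschitzWith R (truncLinear R r b c) := by
  have h1 : LipschitzWith R fun x : E n => (R : ℝ) * max 0 (r - ‖x - c‖) := by
    have : LipschitzWith 1 fun x : E n => max 0 (r - ‖x - c‖) := by
      have h : LipschitzWith 1 fun x : E n => r - ‖x - c‖ := by
        refine LipschitzWith.of_dist_le_mul fun x y => ?_
        rw [Real.dist_eq, dist_eq_norm, NNReal.coe_one, one_mul, sub_sub_sub_cancel_left]
        refine (abs_norm_sub_norm_le _ _).trans_eq ?_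
        rw [sub_sub_sub_cancel_right, norm_sub_rev]
      exact h.const_max 0
    refine LipschitzWith.of_dist_le_mul fun x y => ?_
    rw [Real.dist_eq, ← mul_sub, abs_mul, abs_of_nonneg R.coe_nonneg]
    have := this.dist_le_mul x y
    rw [NNReal.coe_one, one_mul, Real.dist_eq] at this
    exact mul_le_mul_of_nonneg_left this R.2
  have h2 : LipschitzWith R fun x : E n => inner ℝ b (x - c) := by
    refine LipschitzWith.of_dist_le_mul fun x y => ?_
    rw [Real.dist_eq, ← inner_sub_right, sub_sub_sub_cancel_right, dist_eq_norm]
    exact (abs_real_inner_le_norm _ _).trans (by gcongr)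
  have h3 := h1.neg.max (h1.min h2)
  rw [max_self, max_self] at h3
  exact h3

theorem truncLinear_eq_zero {R r : ℝ} {b c x : E n} (hx : x ∉ ball c r) :
    truncLinear R r b c x = 0 := by
  rw [mem_ball, dist_eq_norm, not_lt] at hx
  rw [truncLinear, max_eq_left (a := (0 : ℝ)) (by linarith), mul_zero, neg_zero]
  exact max_eq_left (min_le_left _ _)

/-- At half the radius `‖x - c‖ ≤ r - ‖x - c‖`, so the truncating cones of slope `R` are not active.
-/
theorem truncLinear_eq_inner {R r : ℝ} {b c x : E n} (hb : ‖b‖ ≤ R) (hx : x ∈ ball c (r / 2)) :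
    truncLinear R r b c x = inner ℝ b (x - c) := by
  rw [mem_ball, dist_eq_norm] at hx
  have h1 : |inner ℝ b (x - c)| ≤ R * (r - ‖x - c‖) := by
    refine (abs_real_inner_le_norm _ _).trans ?_
    have := norm_nonneg (x - c)
    exact mul_le_mul hb (by linarith) this ((norm_nonneg b).trans hb)
  rw [abs_le] at h1
  rw [truncLinear, max_eq_right (a := (0 : ℝ)) (by linarith [norm_nonneg (x - c)]),
    min_eq_right h1.2, max_eq_right h1.1]

theorem gradient_inner_sub (b c x : E n) : gradient (fun y => inner ℝ b (y - c)) x = b := by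
  refine HasGradientAt.gradient ?_
  rw [hasGradientAt_iff_hasFDerivAt]
  have := (InnerProductSpace.toDual ℝ (E n) b).hasFDerivAt.comp x
    ((hasFDerivAt_id x).sub_const c)
  exact this

/-- A sequence of disjoint balls in the unit cube. -/
theorem exists_disjoint_balls [NeZero n] : ∃ (c : ℕ → E n) (r : ℕ → ℝ), (∀ k, 0 < r k) ∧
    (∀ k, ball (c k) (r k) ⊆ unitCube n) ∧
      ∀ k l x, x ∈ ball (c k) (r k) → x ∈ ball (c l) (r l) → k = l := by
  -- The `k`-th ball lies in the dyadic slab `2 ^ (-k-1) < x 0 < 2 ^ (-k)`, whose midpoint and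
  -- half-width give centre and radius.
  set c : ℕ → E n := fun k => WithLp.toLp 2 fun i => if i = 0 then 3 / 4 * (1 / 2) ^ k else 1 / 2
  set r : ℕ → ℝ := fun k => (1 / 2) ^ k / 4
  have hr : ∀ k, 0 < r k := fun k => by positivity
  have hr1 : ∀ k, ((1 : ℝ) / 2) ^ k ≤ 1 := fun k => pow_le_one₀ (by norm_num) (by norm_num)
  have h0 : ∀ k x, x ∈ ball (c k) (r k) → (1 / 2) ^ k / 2 < x 0 ∧ x 0 < (1 / 2) ^ k := by
    intro k x hx
    rw [mem_ball, dist_eq_norm] at hx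
    have h1 := (abs_apply_le_norm (x - c k) 0).trans_lt hx
    have h2 : (x - c k) 0 = x 0 - 3 / 4 * (1 / 2) ^ k := by simp [c]
    rw [h2, abs_lt] at h1
    simp only [r] at h1
    constructor <;> linarith
  have hlt : ∀ k l x, k < l → x ∈ ball (c k) (r k) → x ∈ ball (c l) (r l) → False := by
    intro k l x hkl hk hl
    have h1 : ((1 : ℝ) / 2) ^ l ≤ (1 / 2) ^ (k + 1) :=
      pow_le_pow_of_le_one (by norm_num) (by norm_num) hkl
    rw [pow_succ] at h1
    linarith [(h0 k x hk).1, (h0 l x hl).2]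
  refine ⟨c, r, hr, fun k x hx i => ?_, fun k l x hk hl => ?_⟩
  · by_cases hi : i = 0
    · subst hi
      have := h0 k x hx
      exact ⟨lt_trans (by positivity) this.1, this.2.trans_le (hr1 k)⟩
    · rw [mem_ball, dist_eq_norm] at hx
      have h1 := (abs_apply_le_norm (x - c k) i).trans_lt hx
      have h2 : (x - c k) i = x i - 1 / 2 := by simp [c, hi]
      rw [h2, abs_lt] at h1
      have := hr1 k
      simp only [r] at h1
      constructor <;> linarith
  · rcases lt_trichotomy k l with h | h | h
    · exact (hlt k l x h hk hl).elim
    · exact h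
    · exact (hlt l k x h hl hk).elim

/-- If `h` were unbounded on this set, one admissible Lipschitz map could have gradient `B k` on the
`k`-th of infinitely many disjoint balls, with `|h (B k)|` exceeding the reciprocal volume of that
ball. Each ball then contributes at least 1 to the integral of `|h|`, contradicting its finiteness.
-/
theorem IsQuasiconvex.exists_bound {m : ℕ} [NeZero n] {h : Matrix (Fin m) (Fin n) ℝ → ℝ}
    (hq : IsQuasiconvex h) (R : NNReal) :
    ∃ M : ℝ, ∀ B : Matrix (Fin m) (Fin n) ℝ, (∀ j, ‖(WithLp.toLp 2 (B j) : E n)‖ ≤ R) →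
      |h B| ≤ M := by
  by_contra! hM
  obtain ⟨c, r, hr, hsub, hdisj⟩ := exists_disjoint_balls (n := n)
  choose B hB hBh using fun k => hM (volume (ball (c k) (r k / 2))).toReal⁻¹
  set b : ℕ → Fin m → E n := fun k j => WithLp.toLp 2 (B k j)
  set f : Fin m → E n → ℝ := fun j x => ∑' k, truncLinear R (r k) (b k j) (c k) x
  have hne : ∀ k j x, truncLinear R (r k) (b k j) (c k) x ≠ 0 → x ∈ ball (c k) (r k) :=
    fun k j x hx => by_contra fun h' => hx (truncLinear_eq_zero h')
  have hf : ∀ j, LipschitzWith (2 * R) (f j) := fun j =>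
    lipschitzWith_tsum_of_disjoint (fun k => lipschitzWith_truncLinear (r k) (c k) (hB k j))
      fun k l x hk hl => hdisj k l x (hne k j x hk) (hne l j x hl)
  have hf0 : ∀ j, ∀ x ∉ unitCube n, f j x = 0 := fun j x hx => by
    simp only [f, fun k => truncLinear_eq_zero (R := R) (b := b k j) fun h' => hx (hsub k h'),
      tsum_zero]
  have hgrad : ∀ k, ∀ x ∈ ball (c k) (r k / 2), jacobian f x = B k := by
    intro k x hx
    have hrow : ∀ j, gradient (f j) x = b k j := fun j => by
      rw [← gradient_inner_sub (b k j) (c k) x]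
      refine Filter.EventuallyEq.gradient_eq ?_
      filter_upwards [isOpen_ball.mem_nhds hx] with y hy
      have hy' : y ∈ ball (c k) (r k) := ball_subset_ball (by linarith [hr k]) hy
      simp only [f]
      rw [tsum_eq_single k fun l hl => by_contra fun h' => hl (hdisj l k y (hne l j y h') hy'),
        truncLinear_eq_inner (hB k j) hy]
    ext j i
    have := congrArg (fun v : E n => v i) (hrow j)
    exact this
  have hint := (hq.le_setIntegral_jacobian 0 hf hf0).1.2
  simp only [zero_add] at hint
  refine hint.ne (top_le_iff.1 ?_)
  have hd : Pairwise (Function.onFun Disjoint fun k => ball (c k) (r k / 2)) := fun k l hkl =>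
    Set.disjoint_left.2 fun x hk hl => hkl (hdisj k l x
      (ball_subset_ball (by linarith [hr k]) hk) (ball_subset_ball (by linarith [hr l]) hl))
  calc (⊤ : ENNReal) = ∑' _ : ℕ, (1 : ENNReal) :=
        (ENNReal.tsum_const_eq_top_of_ne_zero one_ne_zero).symm
    _ ≤ ∑' k, ∫⁻ x in ball (c k) (r k / 2), ‖h (jacobian f x)‖ₑ := by
        refine ENNReal.tsum_le_tsum fun k => ?_
        rw [setLIntegral_congr_fun (g := fun _ => ‖h (B k)‖ₑ) measurableSet_ball
          fun x hx => by simp only [hgrad k x hx], setLIntegral_const]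
        have hv0 : volume (ball (c k) (r k / 2)) ≠ 0 :=
          (measure_ball_pos _ _ (by linarith [hr k])).ne'
        have hvt : volume (ball (c k) (r k / 2)) ≠ ⊤ := measure_ball_lt_top.ne
        calc (1 : ENNReal) = (volume (ball (c k) (r k / 2)))⁻¹ * volume (ball (c k) (r k / 2)) :=
              (ENNReal.inv_mul_cancel hv0 hvt).symm
          _ ≤ _ := by
            gcongr
            rw [Real.enorm_eq_ofReal_abs, ENNReal.le_ofReal_iff_toReal_le
              (ENNReal.inv_ne_top.2 hv0) (abs_nonneg _), ENNReal.toReal_inv]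
            exact (hBh k).le
    _ = ∫⁻ x in ⋃ k, ball (c k) (r k / 2), ‖h (jacobian f x)‖ₑ :=
        (lintegral_iUnion (fun _ => measurableSet_ball) hd _).symm
    _ ≤ _ := lintegral_mono_set (iUnion_subset fun k =>
        (ball_subset_ball (by linarith [hr k])).trans (hsub k))

/-! ### Periodic fields are admissible for quasiconvexity -/

theorem measurable_comp_jacobian {m : ℕ} {h : Matrix (Fin m) (Fin n) ℝ → ℝ}
    (hh : Measurable[borel (Matrix (Fin m) (Fin n) ℝ)] h) (A : Matrix (Fin m) (Fin n) ℝ)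
    (f : Fin m → E n → ℝ) : Measurable fun x => h (A + jacobian f x) := by
  have h1 : Measurable fun x => (fun j i => A j i + gradient (f j) x i : Fin m → Fin n → ℝ) :=
    measurable_pi_iff.2 fun j => measurable_pi_iff.2 fun i =>
      ((EuclideanSpace.proj i : E n →L[ℝ] ℝ).continuous.measurable.comp
        (measurable_gradient (f j))).const_add _
  -- The product σ-algebra used so far is the Borel one, for which `h` is measurable.
  rw [BorelSpace.measurable_eq (α := Fin m → Fin n → ℝ)] at h1
  exact @Measurable.comp _ _ _ _ (borel _) _ _ _ hh h1

theorem gradient_rescale (V : E n → ℝ) {a : ℝ} (ha : a ≠ 0) (x : E n) :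
    gradient (fun x => a⁻¹ * V (a • x)) x = gradient V (a • x) := by
  have h : fderiv ℝ (fun x => a⁻¹ * V (a • x)) x = fderiv ℝ V (a • x) := by
    let _ := invertibleOfNonzero (inv_ne_zero ha)
    have := fderiv_const_smul_of_invertible (𝕜 := ℝ) (f := fun x => V (a • x)) (x := x) a⁻¹
    rw [fderiv_comp_smul, smul_smul, inv_mul_cancel₀ ha, one_smul] at this
    exact this
  rw [gradient, gradient, h]

theorem gradient_periodic {V : E n → ℝ} {a : E n} (hV : ∀ x, V (x + a) = V x) (x : E n) :
    gradient V (x + a) = gradient V x := by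
  rw [← gradient_comp_add_right]; simp only [hV]

/-- A rescaling of `V`, cut off near the boundary of the unit cube. -/
noncomputable def cutoffRescale (a : ℝ) (V : E n → ℝ) (x : E n) : ℝ :=
  min 1 (a * infDist x (unitCube n)ᶜ) * (a⁻¹ * V (a • x))

/-- The cutoff has slope `a` but multiplies a function of size `M / a`, so the constant does not
depend on `a`. -/
theorem lipschitzWith_cutoffRescale {V : E n → ℝ} {K M : NNReal} (hK : LipschitzWith K V)
    (hM : ∀ x, |V x| ≤ M) {a : ℝ} (ha : 0 < a) :
    LipschitzWith (K + M) (cutoffRescale a V) := by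
  set η : E n → ℝ := fun x => min 1 (a * infDist x (unitCube n)ᶜ)
  set W : E n → ℝ := fun x => a⁻¹ * V (a • x)
  have hη0 : ∀ x, |η x| ≤ 1 := fun x => by
    rw [abs_of_nonneg (le_min zero_le_one (mul_nonneg ha.le infDist_nonneg))]
    exact min_le_left _ _
  have hη : ∀ x y, |η x - η y| ≤ a * dist x y := fun x y => by
    have h1 := (lipschitz_infDist_pt (unitCube n)ᶜ).dist_le_mul x y
    rw [NNReal.coe_one, one_mul, Real.dist_eq] at h1
    calc _ ≤ |a * infDist x (unitCube n)ᶜ - a * infDist y (unitCube n)ᶜ| := by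
          have := abs_min_sub_min_le_max 1 (a * infDist x (unitCube n)ᶜ) 1
            (a * infDist y (unitCube n)ᶜ)
          simpa using this
      _ = a * |infDist x (unitCube n)ᶜ - infDist y (unitCube n)ᶜ| := by
          rw [← mul_sub, abs_mul, abs_of_pos ha]
      _ ≤ _ := by gcongr
  have hW : ∀ x y, |W x - W y| ≤ K * dist x y := fun x y => by
    have h1 := hK.dist_le_mul (a • x) (a • y)
    rw [Real.dist_eq, dist_smul₀, Real.norm_of_nonneg ha.le] at h1
    calc _ = a⁻¹ * |V (a • x) - V (a • y)| := by
          rw [← mul_sub, abs_mul, abs_of_pos (inv_pos.2 ha)]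
      _ ≤ a⁻¹ * (K * (a * dist x y)) := by gcongr
      _ = _ := by field_simp
  have hW0 : ∀ x, |W x| ≤ a⁻¹ * M := fun x => by
    rw [abs_mul, abs_of_pos (inv_pos.2 ha)]; gcongr; exact hM _
  refine LipschitzWith.of_dist_le_mul fun x y => ?_
  rw [Real.dist_eq]
  have h1 : cutoffRescale a V x - cutoffRescale a V y =
      η x * (W x - W y) + (η x - η y) * W y := by
    simp only [cutoffRescale, η, W]; ring
  rw [h1]
  refine (abs_add_le _ _).trans ?_
  rw [abs_mul, abs_mul]
  calc _ ≤ 1 * (K * dist x y) + (a * dist x y) * (a⁻¹ * M) := by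
        gcongr
        exacts [hη0 x, hW x y, hη x y, hW0 y]
    _ = _ := by push_cast; field_simp

theorem cutoffRescale_eq_zero {a : ℝ} {V : E n → ℝ} {x : E n} (hx : x ∉ unitCube n) :
    cutoffRescale a V x = 0 := by
  rw [cutoffRescale, infDist_zero_of_mem hx, mul_zero, min_eq_right zero_le_one, zero_mul]

theorem gradient_cutoffRescale {a : ℝ} (ha : a ≠ 0) (V : E n → ℝ) {x : E n}
    (hx : 1 < a * infDist x (unitCube n)ᶜ) :
    gradient (cutoffRescale a V) x = gradient V (a • x) := by
  rw [← gradient_rescale V ha]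
  refine Filter.EventuallyEq.gradient_eq ?_
  have hc : Continuous fun x : E n => a * infDist x (unitCube n)ᶜ :=
    continuous_const.mul (continuous_infDist_pt _)
  filter_upwards [(isOpen_lt continuous_const hc).mem_nhds hx] with y hy
  rw [cutoffRescale, min_eq_left (le_of_lt hy), one_mul]

/-- Quasiconvexity applies to the rescaled and cut-off maps. Off a boundary layer of width `1 / a`
their gradients are those of `V` at `a • x`, and periodicity makes the integral of `F (a • x)`
independent of the integer `a`. The layer contributes nothing in the limit because `h` stays
bounded. -/
theorem IsQuasiconvex.le_setIntegral_periodic {m : ℕ} [NeZero n]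
    {h : Matrix (Fin m) (Fin n) ℝ → ℝ} (hq : IsQuasiconvex h)
    (hh : Measurable[borel (Matrix (Fin m) (Fin n) ℝ)] h) (A : Matrix (Fin m) (Fin n) ℝ)
    {V : Fin m → E n → ℝ} {K M : NNReal} (hK : ∀ j, LipschitzWith K (V j))
    (hM : ∀ j x, |V j x| ≤ M)
    (hper : ∀ j i x, V j (x + EuclideanSpace.single i (1 : ℝ)) = V j x) :
    IntegrableOn (fun y => h (A + jacobian V y)) (unitCube n) volume ∧
      h A ≤ ∫ y in unitCube n, h (A + jacobian V y) := by
  -- The radius covers `A` plus the gradients both of `V` and of all its cut-off rescalings.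
  obtain ⟨B, hB⟩ := hq.exists_bound (∑ j, ‖(WithLp.toLp 2 (A j) : E n)‖₊ + (K + M))
  have hbound : ∀ v : Fin m → E n, (∀ j, ‖v j‖ ≤ K + M) →
      |h (A + Matrix.of fun j i => v j i)| ≤ B := by
    refine fun v hv => hB _ fun j => ?_
    have h1 : (WithLp.toLp 2 ((A + Matrix.of fun j i => v j i) j) : E n) =
        WithLp.toLp 2 (A j) + v j := rfl
    have h2 : ‖(WithLp.toLp 2 (A j) : E n)‖₊ ≤ ∑ j, ‖(WithLp.toLp 2 (A j) : E n)‖₊ :=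
      Finset.single_le_sum (f := fun j => ‖(WithLp.toLp 2 (A j) : E n)‖₊)
        (fun _ _ => zero_le) (Finset.mem_univ j)
    rw [h1]
    refine (norm_add_le _ _).trans ?_
    rw [NNReal.coe_add, NNReal.coe_add]
    exact add_le_add (NNReal.coe_le_coe.2 h2) (hv j)
  set F : E n → ℝ := fun x => h (A + jacobian V x)
  have hFm : Measurable F := measurable_comp_jacobian hh A V
  have hFb : ∀ x, |F x| ≤ B := fun x => hbound (fun j => gradient (V j) x) fun j =>
    (norm_gradient_le_of_lipschitzWith (hK j) x).trans (by simp)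
  have hfin : IsFiniteMeasure (volume.restrict (unitCube n)) :=
    ⟨by rw [Measure.restrict_apply_univ, volume_unitCube]; exact ENNReal.one_lt_top⟩
  have hint : ∀ {g : E n → ℝ}, Measurable g → (∀ x, |g x| ≤ B) → IntegrableOn g (unitCube n) :=
    fun hg hgb => Integrable.of_bound hg.aestronglyMeasurable B (.of_forall hgb)
  refine ⟨hint hFm hFb, ?_⟩
  have hFper : ∀ i x, F (x + EuclideanSpace.single i (1 : ℝ)) = F x := fun i x => by
    simp only [F, jacobian, fun j => gradient_periodic (hper j i) x]
  set a : ℕ → ℝ := fun k => ((k + 1 : ℕ) : ℝ)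
  have ha : ∀ k, 0 < a k := fun k => Nat.cast_pos.2 k.succ_pos
  set g : ℕ → E n → ℝ := fun k x => h (A + jacobian (fun j => cutoffRescale (a k) (V j)) x)
  have hgL : ∀ k j, LipschitzWith (K + M) (cutoffRescale (a k) (V j)) := fun k j =>
    lipschitzWith_cutoffRescale (hK j) (hM j) (ha k)
  have hgm : ∀ k, Measurable (g k) := fun k => measurable_comp_jacobian hh A _
  have hgb : ∀ k x, |g k x| ≤ B := fun k x => hbound _ fun j =>
    (norm_gradient_le_of_lipschitzWith (hgL k j) x).trans_eq (NNReal.coe_add _ _)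
  have hle : ∀ k, h A ≤ (∫ y in unitCube n, (g k y - F (a k • y))) + ∫ y in unitCube n, F y := by
    intro k
    have hFa : Measurable fun y => F (a k • y) := hFm.comp (measurable_const_smul (a k))
    rw [← setIntegral_unitCube_comp_smul k.succ_ne_zero hFm hFper,
      integral_sub (hint (hgm k) (hgb k)) (hint hFa fun x => hFb _), sub_add_cancel]
    exact (hq.le_setIntegral_jacobian A (hgL k) fun j x hx => cutoffRescale_eq_zero hx).2
  have hlim : Tendsto (fun k => ∫ y in unitCube n, (g k y - F (a k • y))) atTop
      (𝓝 (∫ _ in unitCube n, (0 : ℝ))) := by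
    refine tendsto_integral_of_dominated_convergence (fun _ => B + B)
      (fun k => ((hgm k).sub (hFm.comp (measurable_const_smul (a k)))).aestronglyMeasurable)
      (integrable_const _) (fun k => .of_forall fun x => ?_) ?_
    · exact (abs_sub _ _).trans (add_le_add (hgb k x) (hFb _))
    · filter_upwards [ae_restrict_mem (measurableSet_unitCube n)] with x hx
      -- Needed because `infDist` to the empty set is `0` by convention.
      have hne : (unitCube n)ᶜ.Nonempty := ⟨0, fun h => by simpa using (h 0).1⟩
      have hd : 0 < infDist x (unitCube n)ᶜ :=
        ((isOpen_unitCube n).isClosed_compl.notMem_iff_infDist_pos hne).1 fun h => h hx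
      have hat : Tendsto (fun k => a k * infDist x (unitCube n)ᶜ) atTop atTop :=
        ((tendsto_natCast_atTop_atTop (R := ℝ)).comp (tendsto_add_atTop_nat 1)).atTop_mul_const hd
      -- At a fixed point of the cube the two fields coincide for all large `k`, so the difference
      -- is eventually zero.
      refine tendsto_const_nhds.congr' ?_
      filter_upwards [hat.eventually_gt_atTop 1] with k hk
      simp only [g, F, jacobian, fun j => gradient_cutoffRescale (ha k).ne' (V j) hk, sub_self]
  rw [integral_zero] at hlim
  have := ge_of_tendsto (hlim.add_const (∫ y in unitCube n, F y)) (.of_forall hle)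
  rwa [zero_add] at this

/-! ### From quasiconvexity to `α`-quasiconvexity -/

theorem IsQuasiconvex.isAlphaQuasiconvex {m : ℕ} [NeZero n] {α : ℝ} (h0 : 0 < α) (h1 : α < 1)
    {h : Matrix (Fin m) (Fin n) ℝ → ℝ} (hq : IsQuasiconvex h)
    (hh : Measurable[borel (Matrix (Fin m) (Fin n) ℝ)] h) : IsAlphaQuasiconvex α h := by
  intro A u G ⟨hu, hp⟩ hG
  set V : Fin m → E n → ℝ := fun j => rieszPotential α (comp u j)
  have hVc : ∀ j, Continuous (V j) := fun j => continuous_rieszPotential h0 h1 (hu j).1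
  have hper : ∀ j i x, V j (x + EuclideanSpace.single i (1 : ℝ)) = V j x := fun j i x =>
    rieszPotential_periodic h0 h1 (hu j).1
      ((hp i).mono fun y hy => congrArg (fun v : E m => v j) hy) x
  have hK : ∀ j, ∃ K, LipschitzWith K (V j) := fun j => by
    obtain ⟨v, hv, hvb⟩ := (hu j).2
    obtain ⟨L, hL⟩ := ae_norm_le_of_memLp_top hvb
    exact ⟨L, (hv.hasWeakGradient_rieszPotential h0 h1 (hu j).1).lipschitzWith (hVc j) hL⟩
  -- A continuous periodic function is bounded by its maximum on the closed cube.
  have hM : ∀ j, ∃ M : ℝ, ∀ x, |V j x| ≤ M := fun j => by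
    obtain ⟨M, hM⟩ := (isCompact_closure_unitCube n).exists_bound_of_continuousOn
      (hVc j).continuousOn
    exact ⟨M, fun x => by rw [← apply_fractVec (hper j)]; exact hM _ (fractVec_mem x)⟩
  choose K hK using hK
  choose M hM using hM
  have hGV : ∀ᵐ x ∂volume.restrict (unitCube n), jacobian V x = G x := by
    have : ∀ j, gradient (V j) =ᵐ[volume] row G j := fun j => by
      have := (hasWeakGradient_of_lipschitzWith (hK j) univ).ae_eq isOpen_univ
        ((hG j).hasWeakGradient_rieszPotential h0 h1 (hu j).1)
      rwa [Measure.restrict_univ] at this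
    filter_upwards [ae_restrict_of_ae (ae_all_iff.2 this)] with x hx
    ext j i
    have := congrArg (fun v : E n => v i) (hx j)
    exact this
  have hcongr : (fun y => h (A + jacobian V y)) =ᵐ[volume.restrict (unitCube n)]
      fun y => h (A + G y) := by
    filter_upwards [hGV] with y hy
    rw [hy]
  -- Sums over the components serve as common constants for all of them.
  obtain ⟨hi, hle⟩ := hq.le_setIntegral_periodic hh A (K := ∑ j, K j) (M := ∑ j, (M j).toNNReal)
    (fun j => (hK j).weaken (Finset.single_le_sum (fun _ _ => zero_le) (Finset.mem_univ j)))
    (fun j x => (hM j x).trans ((Real.le_coe_toNNReal _).trans (NNReal.coe_le_coe.2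
      (Finset.single_le_sum (f := fun j => (M j).toNNReal) (fun _ _ => zero_le)
        (Finset.mem_univ j))))) hper
  exact ⟨hi.congr hcongr, hle.trans_eq (integral_congr_ae hcongr)⟩

end FracQC

theorem corollary4p5 (m n : ℕ) (α : ℝ) (hα : α ∈ Set.Ioo (0 : ℝ) 1)
    (h : Matrix (Fin m) (Fin n) ℝ → ℝ) (hh : Measurable[borel (Matrix (Fin m) (Fin n) ℝ)] h) :
    FracQC.IsQuasiconvex h ↔ FracQC.IsAlphaQuasiconvex α h := by
  -- For `n = 0` the cube has volume 1 and there is only one matrix, so both inequalities are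
  -- equalities.
  rcases Nat.eq_zero_or_pos n with rfl | hn
  · have key : ∀ (A : Matrix (Fin m) (Fin 0) ℝ) (G : FracQC.E 0 → Matrix (Fin m) (Fin 0) ℝ),
        IntegrableOn (fun y => h (A + G y)) (FracQC.unitCube 0) volume ∧
          h A ≤ ∫ y in FracQC.unitCube 0, h (A + G y) := fun A G => by
      have hA : ∀ y, A + G y = A := fun y => Subsingleton.elim _ _
      simp only [hA]
      refine ⟨integrableOn_const (by simp [FracQC.volume_unitCube]), ?_⟩
      simp [measureReal_def, FracQC.volume_unitCube]
    exact ⟨fun _ A _ G _ _ => key A G, fun _ A _ G _ _ => key A G⟩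
  · have : NeZero n := ⟨hn.ne'⟩
    exact ⟨fun hq => hq.isAlphaQuasiconvex hα.1 hα.2 hh,
      fun hq => hq.isQuasiconvex hα.1 hα.2⟩
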